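/- Let $p\in[1,\infty)\setminus\{2\}$, let $(\Omega,\mathfrak M,\mu)$ be a $\sigma$-finite measure space, let $L^p(\mu)$ be the complex $L^p$-space, and let $\mathcal L(L^p(\mu))$ be the Banach algebra of bounded linear operators on it, with the operator norm. Definitions. A measurable set transformation $S\colon(\Omega_0,\mathfrak M_0,\mu_0)\to(\Omega_1,\mathfrak M_1,\mu_1)$ is a map $S\colon\mathfrak M_0\to\mathfrak M_1$, defined modulo null sets, such that $\mu_1(S(A))=0$ if and only if $\mu_0(A)=0$, $S(\Omega_0\setminus A)=S(\Omega_0)\setminus S(A)$, and $S(\bigcup_j A_j)=\bigcup_j S(A_j)$ for pairwise disjoint $A_1,A_2,\dots\in\mathfrak M_0$. It is bijective if it is bijective on classes of measurable sets modulo null sets. It induces a unique linear map $S_*$ from (classes of) measurable complex functions on $\Omega_0$ to those on $\Omega_1$ with $S_*(\chi_A)=\chi_{S(A)}$ for $A\in\mathfrak M_0$ and with $S_*(\xi_n)\to S_*(\xi)$ a.e. whenever $\xi_n\to\xi$ a.e. If $S$ is bijective and $\lambda\ll\mu_0$ is a measure, then $S_*(\lambda)$ is the measure on $\mathfrak M_1$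 with $S_*(\lambda)(S(A))=\lambda(A)$ for $A\in\mathfrak M_0$. A linear map $s\colon L^p(\mu)\to L^p(\mu)$ is a spatial partial isometry if there are $E,F\in\mathfrak M$, a bijective measurable set transformation $S\colon(E,\mathfrak M|_E,\mu|_E)\to(F,\mathfrak M|_F,\mu|_F)$ and a measurable function $g\colon F\to\mathbb C$ with $|g|=1$ a.e. such that, for every $\xi\in L^p(\mu)$, $$ s(\xi)=\left(\frac{dS_*(\mu|_E)}{d\mu|_F}\right)^{1/p}S_*(\xi|_E)\,g \ \text{ on } F,\qquad s(\xi)=0\ \text{ on }\Omega\setminus F. $$ Proposition. An operator $s\in\mathcal L(L^p(\mu))$ is a spatial partial isometry if and only if there are $t\in\mathcal L(L^p(\mu))$ and idempotents $e,f\in\mathcal L(L^p(\mu))$ such that 1. $e$ and $f$ are spatial partial isometries; 2. $st=f$ and $ts=e$; 3. $fse=s$ and $etf=t$; 4. $\|s\|\le 1$ and $\|t\|\le 1$. -/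

import Mathlib

open MeasureTheory
open scoped ENNReal

noncomputable section

/-- A measurable set transformation `S : (Ω₀, 𝔐, μ) → (Ω₁, 𝔑, ν)`: a map from measurable sets to
measurable sets, defined modulo null sets. It is given by a representative `toFun`, of which only
the values on measurable sets matter, and all set identities hold up to null sets. -/
structure MeasurableSetTransformation {Ω₀ Ω₁ : Type*} [MeasurableSpace Ω₀] [MeasurableSpace Ω₁]
    (μ : Measure Ω₀) (ν : Measure Ω₁) where
  /-- the map on representatives -/
  toFun : Set Ω₀ → Set Ω₁
  measurableSet_toFun : ∀ A, MeasurableSet A → MeasurableSet (toFun A)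
  /-- well defined modulo null sets -/
  congr_toFun : ∀ A B, MeasurableSet A → MeasurableSet B → A =ᵐ[μ] B → toFun A =ᵐ[ν] toFun B
  null_iff : ∀ A, MeasurableSet A → (ν (toFun A) = 0 ↔ μ A = 0)
  compl_toFun : ∀ A, MeasurableSet A → toFun Aᶜ =ᵐ[ν] (toFun Set.univ \ toFun A : Set Ω₁)
  iUnion_toFun : ∀ A : ℕ → Set Ω₀, (∀ n, MeasurableSet (A n)) →
    Pairwise (fun i j => Disjoint (A i) (A j)) →
    toFun (⋃ n, A n) =ᵐ[ν] (⋃ n, toFun (A n) : Set Ω₁)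

namespace MeasurableSetTransformation

variable {Ω₀ Ω₁ : Type*} [MeasurableSpace Ω₀] [MeasurableSpace Ω₁]
  {μ : Measure Ω₀} {ν : Measure Ω₁}

/-- Injectivity on classes of measurable sets modulo null sets. -/
def IsInjective (S : MeasurableSetTransformation μ ν) : Prop :=
  ∀ A B, MeasurableSet A → MeasurableSet B → S.toFun A =ᵐ[ν] S.toFun B → A =ᵐ[μ] B

/-- Surjectivity on classes of measurable sets modulo null sets. -/
def IsSurjective (S : MeasurableSetTransformation μ ν) : Prop :=
  ∀ B, MeasurableSet B → ∃ A, MeasurableSet A ∧ S.toFun A =ᵐ[ν] B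

/-- Bijectivity on classes of measurable sets modulo null sets. -/
def IsBijective (S : MeasurableSetTransformation μ ν) : Prop :=
  S.IsInjective ∧ S.IsSurjective

/-! Elementary facts, needed for the inverse and for the transport of measures. -/

theorem empty_ae (S : MeasurableSetTransformation μ ν) : ∀ᵐ y ∂ν, y ∉ S.toFun ∅ :=
  measure_eq_zero_iff_ae_notMem.1 ((S.null_iff ∅ MeasurableSet.empty).2 measure_empty)

theorem union_ae (S : MeasurableSetTransformation μ ν) {A B : Set Ω₀} (hA : MeasurableSet A)
    (hB : MeasurableSet B) (hAB : Disjoint A B) :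
    ∀ᵐ y ∂ν, y ∈ S.toFun (A ∪ B) ↔ y ∈ S.toFun A ∨ y ∈ S.toFun B := by
  let C : ℕ → Set Ω₀ := fun n => if n = 0 then A else if n = 1 then B else ∅
  have hC : ∀ n, MeasurableSet (C n) := by
    intro n; simp only [C]; split_ifs <;> simp [*]
  have hd : Pairwise (fun i j => Disjoint (C i) (C j)) := by
    intro i j hij
    simp only [C]
    split_ifs <;> first | omega | simp [hAB.symm]
  have hU : (⋃ n, C n) = A ∪ B := by
    ext x
    simp only [Set.mem_iUnion, Set.mem_union, C]
    constructor
    · rintro ⟨n, hn⟩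
      split_ifs at hn
      · exact Or.inl hn
      · exact Or.inr hn
      · exact absurd hn (Set.notMem_empty x)
    · rintro (h | h)
      · exact ⟨0, by simpa using h⟩
      · exact ⟨1, by simpa using h⟩
  have h := Filter.eventuallyEq_set.1 (S.iUnion_toFun C hC hd)
  rw [hU] at h
  filter_upwards [h, S.empty_ae] with y hy h0
  rw [hy, Set.mem_iUnion]
  constructor
  · rintro ⟨n, hn⟩
    simp only [C] at hn
    split_ifs at hn
    · exact Or.inl hn
    · exact Or.inr hn
    · exact absurd hn h0
  · rintro (h | h)
    · exact ⟨0, by simpa [C] using h⟩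
    · exact ⟨1, by simpa [C] using h⟩

theorem mono_ae (S : MeasurableSetTransformation μ ν) {A B : Set Ω₀} (hA : MeasurableSet A)
    (hB : MeasurableSet B) (hAB : A ⊆ B) : ∀ᵐ y ∂ν, y ∈ S.toFun A → y ∈ S.toFun B := by
  have h := S.union_ae hA (hB.diff hA) Set.disjoint_sdiff_right
  rw [Set.union_sdiff_cancel hAB] at h
  filter_upwards [h] with y hy h1
  exact hy.2 (Or.inl h1)

theorem inter_ae (S : MeasurableSetTransformation μ ν) {A B : Set Ω₀} (hA : MeasurableSet A)
    (hB : MeasurableSet B) :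
    ∀ᵐ y ∂ν, y ∈ S.toFun (A ∩ B) ↔ y ∈ S.toFun A ∧ y ∈ S.toFun B := by
  have h1 := S.union_ae (hA.inter hB) (hA.diff hB)
    (Set.disjoint_sdiff_right.mono_left Set.inter_subset_right)
  rw [Set.inter_union_sdiff] at h1
  filter_upwards [h1, S.mono_ae (hA.inter hB) hB Set.inter_subset_right,
    S.mono_ae (hA.diff hB) hB.compl (fun x hx => hx.2),
    Filter.eventuallyEq_set.1 (S.compl_toFun B hB)] with y h1 h2 h3 h4
  rw [h4] at h3
  rw [h1]
  constructor
  · exact fun h => ⟨Or.inl h, h2 h⟩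
  · rintro ⟨h | h, hb⟩
    · exact h
    · exact absurd hb (h3 h).2

theorem iUnion_ae (S : MeasurableSetTransformation μ ν) {A : ℕ → Set Ω₀}
    (hA : ∀ n, MeasurableSet (A n)) :
    ∀ᵐ y ∂ν, y ∈ S.toFun (⋃ n, A n) ↔ ∃ n, y ∈ S.toFun (A n) := by
  have hD : ∀ n, MeasurableSet (disjointed A n) := fun n => MeasurableSet.disjointed hA n
  have h := Filter.eventuallyEq_set.1 (S.iUnion_toFun _ hD (disjoint_disjointed A))
  rw [iUnion_disjointed] at h
  filter_upwards [h, ae_all_iff.2 fun n => S.mono_ae (hD n) (hA n) (disjointed_subset A n),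
    ae_all_iff.2 fun n => S.mono_ae (hA n) (MeasurableSet.iUnion hA) (Set.subset_iUnion A n)]
    with y h1 h2 h3
  constructor
  · intro hy
    obtain ⟨n, hn⟩ := Set.mem_iUnion.1 (h1.1 hy)
    exact ⟨n, h2 n hn⟩
  · rintro ⟨n, hn⟩
    exact h3 n hn

theorem univ_ae_of_isSurjective (S : MeasurableSetTransformation μ ν) (hS : S.IsSurjective) :
    ∀ᵐ y ∂ν, y ∈ S.toFun Set.univ := by
  obtain ⟨A, hA, h⟩ := hS Set.univ MeasurableSet.univ
  filter_upwards [Filter.eventuallyEq_set.1 h,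
    S.mono_ae hA MeasurableSet.univ (Set.subset_univ A)] with y h1 h2
  exact h2 (h1.2 (Set.mem_univ y))

open Classical in
/-- A representative of the inverse of a bijective measurable set transformation. -/
def invFun (S : MeasurableSetTransformation μ ν) (hS : S.IsBijective) (B : Set Ω₁) : Set Ω₀ :=
  if hB : MeasurableSet B then (hS.2 B hB).choose else ∅

theorem measurableSet_invFun (S : MeasurableSetTransformation μ ν) (hS : S.IsBijective)
    {B : Set Ω₁} (hB : MeasurableSet B) : MeasurableSet (S.invFun hS B) := by
  rw [invFun, dif_pos hB]; exact (hS.2 B hB).choose_spec.1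

theorem toFun_invFun (S : MeasurableSetTransformation μ ν) (hS : S.IsBijective)
    {B : Set Ω₁} (hB : MeasurableSet B) : S.toFun (S.invFun hS B) =ᵐ[ν] B := by
  rw [invFun, dif_pos hB]; exact (hS.2 B hB).choose_spec.2

/-- The inverse `S⁻¹ : (Ω₁, 𝔑, ν) → (Ω₀, 𝔐, μ)` of a bijective measurable set transformation. -/
def symm (S : MeasurableSetTransformation μ ν) (hS : S.IsBijective) :
    MeasurableSetTransformation ν μ where
  toFun := S.invFun hS
  measurableSet_toFun B hB := S.measurableSet_invFun hS hB
  congr_toFun A B hA hB h :=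
    hS.1 _ _ (S.measurableSet_invFun hS hA) (S.measurableSet_invFun hS hB)
      (((S.toFun_invFun hS hA).trans h).trans (S.toFun_invFun hS hB).symm)
  null_iff B hB := by
    rw [← S.null_iff _ (S.measurableSet_invFun hS hB), measure_congr (S.toFun_invFun hS hB)]
  compl_toFun B hB := by
    have hm := S.measurableSet_invFun hS hB
    have hu := S.measurableSet_invFun hS (MeasurableSet.univ (α := Ω₁))
    refine hS.1 _ _ (S.measurableSet_invFun hS hB.compl) (hu.diff hm) ?_
    rw [Set.sdiff_eq]
    refine Filter.eventuallyEq_set.2 ?_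
    filter_upwards [Filter.eventuallyEq_set.1 (S.toFun_invFun hS hB.compl),
      Filter.eventuallyEq_set.1 (S.toFun_invFun hS hB),
      Filter.eventuallyEq_set.1 (S.toFun_invFun hS MeasurableSet.univ),
      S.inter_ae hu hm.compl, Filter.eventuallyEq_set.1 (S.compl_toFun _ hm),
      S.univ_ae_of_isSurjective hS.2] with y h1 h2 h3 h4 h5 h6
    rw [h1, h4, h3, h5, Set.mem_sdiff, h2]
    simp [h6]
  iUnion_toFun B hB hd := by
    have hm := fun n => S.measurableSet_invFun hS (hB n)
    refine hS.1 _ _ (S.measurableSet_invFun hS (MeasurableSet.iUnion hB))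
      (MeasurableSet.iUnion hm) ?_
    refine Filter.eventuallyEq_set.2 ?_
    filter_upwards [Filter.eventuallyEq_set.1 (S.toFun_invFun hS (MeasurableSet.iUnion hB)),
      ae_all_iff.2 fun n => Filter.eventuallyEq_set.1 (S.toFun_invFun hS (hB n)),
      S.iUnion_ae hm] with y h1 h2 h3
    rw [h1, h3, Set.mem_iUnion]
    exact exists_congr fun n => (h2 n).symm

/-- The pullback `S^*(κ)(A) = κ(S(A))` of a measure `κ ≪ ν`. -/
def pullbackMeasure (S : MeasurableSetTransformation μ ν) (κ : Measure Ω₁) (hκ : κ ≪ ν) :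
    Measure Ω₀ :=
  Measure.ofMeasurable (fun A _ => κ (S.toFun A))
    (hκ ((S.null_iff ∅ MeasurableSet.empty).2 measure_empty))
    (by
      intro A hA hd
      rw [measure_congr (hκ.ae_le (S.iUnion_toFun A hA hd))]
      refine measure_iUnion₀ ?_ fun n => (S.measurableSet_toFun _ (hA n)).nullMeasurableSet
      intro i j hij
      refine measure_eq_zero_iff_ae_notMem.2 (hκ.ae_le ?_)
      have h := S.inter_ae (hA i) (hA j)
      rw [Set.disjoint_iff_inter_eq_empty.1 (hd hij)] at h
      filter_upwards [h, S.empty_ae] with y h1 h2 h3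
      exact h2 (h1.2 h3))

/-- The pushforward `S_*(κ) = (S⁻¹)^*(κ)` of a measure `κ ≪ μ` along a bijective `S`. -/
def pushforwardMeasure (S : MeasurableSetTransformation μ ν) (hS : S.IsBijective)
    (κ : Measure Ω₀) (hκ : κ ≪ μ) : Measure Ω₁ :=
  (S.symm hS).pullbackMeasure κ hκ

/-- `S_*(κ)` is determined by `S_*(κ)(S(A)) = κ(A)`. -/
theorem pushforwardMeasure_toFun (S : MeasurableSetTransformation μ ν) (hS : S.IsBijective)
    (κ : Measure Ω₀) (hκ : κ ≪ μ) {A : Set Ω₀} (hA : MeasurableSet A) :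
    S.pushforwardMeasure hS κ hκ (S.toFun A) = κ A := by
  rw [pushforwardMeasure, pullbackMeasure,
    Measure.ofMeasurable_apply _ (S.measurableSet_toFun A hA)]
  refine measure_congr (hκ.ae_le (hS.1 _ _ ?_ hA ?_))
  · exact S.measurableSet_invFun hS (S.measurableSet_toFun A hA)
  · exact S.toFun_invFun hS (S.measurableSet_toFun A hA)

/-- The pushforward `S_*(ξ)` of a real measurable function. It is the function, unique up to null
sets, with `{S_*(ξ) > q} = S({ξ > q})` on `S(Ω₀)` for every rational `q`, extended by `0`
outside `S(Ω₀)`. -/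
def pushforwardReal (S : MeasurableSetTransformation μ ν) (ξ : Ω₀ → ℝ) (y : Ω₁) : ℝ :=
  sSup {r : ℝ | ∃ q : ℚ, r = (q : ℝ) ∧ y ∈ S.toFun {x | (q : ℝ) < ξ x}}

/-- `S_*(ξ)` is determined by its level sets, `{S_*(ξ) > c} = S({ξ > c})`. -/
theorem lt_pushforwardReal_iff_ae (S : MeasurableSetTransformation μ ν) {ξ : Ω₀ → ℝ}
    (hξ : Measurable ξ) (c : ℝ) :
    ∀ᵐ y ∂ν, y ∈ S.toFun Set.univ →
      (c < S.pushforwardReal ξ y ↔ y ∈ S.toFun {x | c < ξ x}) := by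
  have hm : ∀ a : ℝ, MeasurableSet {x | a < ξ x} := fun a => measurableSet_lt measurable_const hξ
  obtain ⟨q₀, hq₀⟩ := exists_rat_gt c
  have : Nonempty {q : ℚ // c < q} := ⟨⟨q₀, hq₀⟩⟩
  obtain ⟨u, hu⟩ := exists_surjective_nat {q : ℚ // c < q}
  have e1 : (⋃ n, {x | ((u n : ℚ) : ℝ) < ξ x}) = {x | c < ξ x} := by
    ext x
    simp only [Set.mem_iUnion, Set.mem_ofPred_eq]
    constructor
    · rintro ⟨n, hn⟩; exact (u n).2.trans hn
    · intro h
      obtain ⟨q, h1, h2⟩ := exists_rat_btwn h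
      obtain ⟨n, hn⟩ := hu ⟨q, h1⟩
      exact ⟨n, by rw [hn]; exact h2⟩
  have e2 : (⋃ n : ℕ, {x | ((-(n : ℚ) : ℚ) : ℝ) < ξ x}) = Set.univ := by
    ext x
    simp only [Set.mem_iUnion, Set.mem_ofPred_eq, Set.mem_univ, iff_true]
    obtain ⟨n, hn⟩ := exists_nat_gt (-ξ x)
    exact ⟨n, by push_cast; linarith⟩
  have e3 : (⋃ n : ℕ, {x | (n : ℝ) < ξ x}ᶜ) = Set.univ := by
    ext x
    simp only [Set.mem_iUnion, Set.mem_compl_iff, Set.mem_ofPred_eq, Set.mem_univ, iff_true, not_lt]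
    exact exists_nat_ge (ξ x)
  have h1 := S.iUnion_ae fun n => hm ((u n : ℚ) : ℝ)
  have h2 := S.iUnion_ae fun n : ℕ => hm ((-(n : ℚ) : ℚ) : ℝ)
  have h3 := S.iUnion_ae fun n : ℕ => (hm (n : ℝ)).compl
  rw [e1] at h1
  rw [e2] at h2
  rw [e3] at h3
  have h4 : ∀ᵐ y ∂ν, ∀ q : ℚ, ∀ n : ℕ, (n : ℝ) < q →
      y ∈ S.toFun {x | (q : ℝ) < ξ x} → y ∈ S.toFun {x | (n : ℝ) < ξ x} := by
    refine ae_all_iff.2 fun q => ae_all_iff.2 fun n => ?_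
    by_cases h : (n : ℝ) < q
    · filter_upwards [S.mono_ae (hm q) (hm n) (fun x hx => lt_trans h hx)] with y hy _
      exact hy
    · exact Filter.Eventually.of_forall fun y h' => absurd h' h
  filter_upwards [h1, h2, h3, h4, ae_all_iff.2 fun n : ℕ =>
    Filter.eventuallyEq_set.1 (S.compl_toFun _ (hm (n : ℝ)))] with y h1 h2 h3 h4 h5 hy
  obtain ⟨a, ha⟩ := h2.1 hy
  obtain ⟨b, hb⟩ := h3.1 hy
  have hb' := ((h5 b).1 hb).2
  rw [pushforwardReal, lt_csSup_iff, h1]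
  · constructor
    · rintro ⟨_, ⟨q, rfl, hq⟩, hcq⟩
      obtain ⟨n, hn⟩ := hu ⟨q, hcq⟩
      exact ⟨n, by rw [hn]; exact hq⟩
    · rintro ⟨n, hn⟩
      exact ⟨_, ⟨_, rfl, hn⟩, (u n).2⟩
  · refine ⟨b, ?_⟩
    rintro _ ⟨q, rfl, hq⟩
    by_contra hlt
    exact hb' (h4 q b (not_le.1 hlt) hq)
  · exact ⟨_, _, rfl, ha⟩

/-- The map `S_* : L⁰(μ) → L⁰(ν)`, applied to representatives: the linear map, continuous for
pointwise almost everywhere convergence of sequences, with `S_*(χ_A) = χ_{S(A)}`. -/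
def pushforward (S : MeasurableSetTransformation μ ν) (ξ : Ω₀ → ℂ) (y : Ω₁) : ℂ :=
  (S.pushforwardReal (fun x => (ξ x).re) y : ℂ) +
    (S.pushforwardReal (fun x => (ξ x).im) y : ℂ) * Complex.I

end MeasurableSetTransformation

/-- A spatial system `(E, F, S, g)` for `(Ω₀, μ)` and `(Ω₁, ν)`. The measure space
`(E, 𝔐|_E, μ|_E)` is presented on all of `Ω₀` by the restricted measure `μ.restrict E`, for which
the complement of `E` is null, and likewise for `F`; so `S` is a bijection from the measurable
subsets of `E` modulo `μ` onto the measurable subsets of `F` modulo `ν`. -/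
structure SpatialSystem {Ω₀ Ω₁ : Type*} [MeasurableSpace Ω₀] [MeasurableSpace Ω₁]
    (μ : Measure Ω₀) (ν : Measure Ω₁) where
  E : Set Ω₀
  F : Set Ω₁
  measurableSet_E : MeasurableSet E
  measurableSet_F : MeasurableSet F
  S : MeasurableSetTransformation (μ.restrict E) (ν.restrict F)
  bijective_S : S.IsBijective
  g : Ω₁ → ℂ
  measurable_g : Measurable g
  norm_g : ∀ᵐ y ∂(ν.restrict F), ‖g y‖ = 1

/-- The Radon-Nikodym derivative `dS_*(μ|_E) / dν|_F`. -/
def SpatialSystem.density {Ω₀ Ω₁ : Type*} [MeasurableSpace Ω₀] [MeasurableSpace Ω₁]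
    {μ : Measure Ω₀} {ν : Measure Ω₁} (σ : SpatialSystem μ ν) : Ω₁ → ℝ≥0∞ :=
  (σ.S.pushforwardMeasure σ.bijective_S (μ.restrict σ.E)
    Measure.AbsolutelyContinuous.rfl).rnDeriv (ν.restrict σ.F)

/-- A linear map `s : L^p(μ) → L^p(ν)` is a spatial partial isometry if, for some spatial system
`(E, F, S, g)`, `s(ξ) = (dS_*(μ|_E)/dν|_F)^{1/p} S_*(ξ|_E) g` on `F` and `s(ξ) = 0` off `F`. -/
def IsSpatialPartialIsometry {Ω₀ Ω₁ : Type*} [MeasurableSpace Ω₀] [MeasurableSpace Ω₁]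
    {μ : Measure Ω₀} {ν : Measure Ω₁} {p : ℝ≥0∞} (s : Lp ℂ p μ →ₗ[ℂ] Lp ℂ p ν) : Prop :=
  ∃ σ : SpatialSystem μ ν, ∀ ξ : Lp ℂ p μ,
    (s ξ : Ω₁ → ℂ) =ᵐ[ν] σ.F.indicator fun y =>
      (((σ.density y).toReal ^ (1 / p.toReal) : ℝ) : ℂ) * σ.S.pushforward (ξ : Ω₀ → ℂ) y * σ.g y

end

/-! For `p < ∞`, a spatial system maps `L^p(E)` isometrically onto `L^p(F)` and kills functions
supported off `E`. The norm identity `‖s ξ‖ = ‖χ_E ξ‖` (`norm_apply`) is a change of variables,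
since the Radon-Nikodym derivative enters with exponent `1/p`. Surjectivity (`exists_apply_eq`)
comes from dividing by the weight and transporting along `S⁻¹`. Inverting `s` between these
subspaces gives `t`, with `e` and `f` the multiplications by `χ_E` and `χ_F`.

Conversely, an idempotent `e` with `‖e ξ‖ = ‖χ_E ξ‖` is multiplication by `χ_E`, so `e` and `f` are
such multiplications, and contractivity forces `‖s x‖ = ‖χ_E x‖` and `‖t y‖ = ‖χ_F y‖`. What remains
is the Banach–Lamperti theorem. For `p ≠ 2`, equality in Clarkson's inequality characterises
disjoint supports by norms alone (`clarkson_eq_iff`), so `s` and `t` preserve disjointness. With `w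
∈ L^p` nonzero almost everywhere, `A ↦ supp s(χ_A w)` is then a bijective set transformation `S`.
Comparing norms over all sets gives `|s w| = (density)^{1/p} |S_* w|` on `F`; the quotient is the
phase `g`, and the resulting operator agrees with `s` on every `χ_A w`, hence everywhere.

Identities for `S_*` are obtained from a description by preimages of measurable sets
(`IsPushforward`): the sets for which it holds form a σ-algebra, so generators suffice. -/

/-! ### Functions corresponding under a set transformation -/

namespace MeasurableSetTransformation

variable {Ω₀ Ω₁ : Type*} [MeasurableSpace Ω₀] [MeasurableSpace Ω₁]
  {μ : Measure Ω₀} {ν : Measure Ω₁} {X Y : Type*} [MeasurableSpace X] [MeasurableSpace Y]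

/-- `ζ` corresponds to `ξ` under `S`: up to null sets, `ζ⁻¹(B) = S(ξ⁻¹(B))` for measurable `B`. -/
def IsPushforward (S : MeasurableSetTransformation μ ν) (ξ : Ω₀ → X) (ζ : Ω₁ → X) : Prop :=
  ∀ B, MeasurableSet B → ∀ᵐ y ∂ν, ζ y ∈ B ↔ y ∈ S.toFun (ξ ⁻¹' B)

/-- The sets `B` with measurable `ξ⁻¹(B)` for which `ζ⁻¹(B) = S(ξ⁻¹(B))` up to null sets. -/
@[reducible] def pushforwardSpace (S : MeasurableSetTransformation μ ν)
    (hS : ∀ᵐ y ∂ν, y ∈ S.toFun Set.univ) {X : Type*} (ξ : Ω₀ → X) (ζ : Ω₁ → X) :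
    MeasurableSpace X where
  MeasurableSet' B := MeasurableSet (ξ ⁻¹' B) ∧ ∀ᵐ y ∂ν, ζ y ∈ B ↔ y ∈ S.toFun (ξ ⁻¹' B)
  measurableSet_empty := by
    refine ⟨by simp, ?_⟩
    filter_upwards [S.empty_ae] with y hy
    simpa using hy
  measurableSet_compl _ hB := by
    refine ⟨hB.1.compl, ?_⟩
    filter_upwards [hB.2, Filter.eventuallyEq_set.1 (S.compl_toFun _ hB.1), hS] with y h1 h2 h3
    rw [Set.preimage_compl, h2, Set.mem_compl_iff, h1]
    simp [h3]
  measurableSet_iUnion _ hB := by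
    refine ⟨by rw [Set.preimage_iUnion]; exact MeasurableSet.iUnion fun n => (hB n).1, ?_⟩
    filter_upwards [ae_all_iff.2 fun n => (hB n).2, S.iUnion_ae fun n => (hB n).1] with y h1 h2
    rw [Set.preimage_iUnion, h2, Set.mem_iUnion]
    exact exists_congr h1

theorem IsPushforward.comp {S : MeasurableSetTransformation μ ν} {ξ : Ω₀ → X} {ζ : Ω₁ → X}
    (h : S.IsPushforward ξ ζ) {φ : X → Y} (hφ : Measurable φ) :
    S.IsPushforward (fun x => φ (ξ x)) (fun y => φ (ζ y)) :=
  fun _ hB => h _ (hφ hB)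

/-- The good sets form a σ-algebra containing the preimages of measurable sets under both
projections, which generate the product. Composed with addition or multiplication on `ℂ × ℂ`, this
makes `S_*` additive and multiplicative. -/
theorem IsPushforward.prodMk {S : MeasurableSetTransformation μ ν}
    (hS : ∀ᵐ y ∂ν, y ∈ S.toFun Set.univ) {ξ : Ω₀ → X} {ζ : Ω₁ → X} {ξ' : Ω₀ → Y} {ζ' : Ω₁ → Y}
    (hξ : Measurable ξ) (hξ' : Measurable ξ')
    (h : S.IsPushforward ξ ζ) (h' : S.IsPushforward ξ' ζ') :
    S.IsPushforward (fun x => (ξ x, ξ' x)) (fun y => (ζ y, ζ' y)) := by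
  have hle : Prod.instMeasurableSpace ≤
      S.pushforwardSpace hS (fun x => (ξ x, ξ' x)) (fun y => (ζ y, ζ' y)) := by
    refine sup_le ?_ ?_
    · rintro _ ⟨C, hC, rfl⟩
      exact ⟨hξ hC, h C hC⟩
    · rintro _ ⟨C, hC, rfl⟩
      exact ⟨hξ' hC, h' C hC⟩
  exact fun B hB => (hle B hB).2

theorem _root_.Complex.measurableSpace_eq_sup : (inferInstance : MeasurableSpace ℂ) =
    MeasurableSpace.comap Complex.re inferInstance ⊔
      MeasurableSpace.comap Complex.im inferInstance := by
  refine Complex.measurableEquivRealProd.measurableEmbedding.comap_eq.symm.trans ?_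
  exact (MeasurableSpace.comap_sup).trans
    (congrArg₂ _ MeasurableSpace.comap_comp MeasurableSpace.comap_comp)

/-- The definition of `S_*` controls only the sets `{re > c}` and `{im > c}`; these generate the
Borel σ-algebra of `ℂ`. -/
theorem isPushforward_pushforward (S : MeasurableSetTransformation μ ν)
    (hS : ∀ᵐ y ∂ν, y ∈ S.toFun Set.univ) {ξ : Ω₀ → ℂ} (hξ : Measurable ξ) :
    S.IsPushforward ξ (S.pushforward ξ) := by
  have hle : (inferInstance : MeasurableSpace ℂ) ≤
      S.pushforwardSpace hS ξ (S.pushforward ξ) := by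
    rw [Complex.measurableSpace_eq_sup]
    refine sup_le (Measurable.comap_le (measurable_of_Ioi fun c => ⟨?_, ?_⟩))
      (Measurable.comap_le (measurable_of_Ioi fun c => ⟨?_, ?_⟩))
    · exact (Complex.measurable_re.comp hξ) measurableSet_Ioi
    · filter_upwards [S.lt_pushforwardReal_iff_ae (Complex.measurable_re.comp hξ) c, hS] with y hy h
      simpa [pushforward, Set.preimage, Function.comp_def] using hy h
    · exact (Complex.measurable_im.comp hξ) measurableSet_Ioi
    · filter_upwards [S.lt_pushforwardReal_iff_ae (Complex.measurable_im.comp hξ) c, hS] with y hy h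
      simpa [pushforward, Set.preimage, Function.comp_def] using hy h
  exact fun B hB => (hle B hB).2

/-- Countably many Borel sets separate the points of `ℂ`, so two functions whose preimages agree
modulo null sets agree almost everywhere. -/
theorem IsPushforward.ae_eq {S : MeasurableSetTransformation μ ν} {ξ : Ω₀ → ℂ} {ζ ζ' : Ω₁ → ℂ}
    (h : S.IsPushforward ξ ζ) (h' : S.IsPushforward ξ ζ') : ζ =ᵐ[ν] ζ' := by
  refine Filter.EventuallyEq.of_forall_separating_preimage MeasurableSet fun B hB => ?_
  refine Filter.eventuallyEq_set.2 ?_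
  filter_upwards [h B hB, h' B hB] with y h1 h2
  exact h1.trans h2.symm

theorem IsPushforward.congr {S : MeasurableSetTransformation μ ν} {ξ ξ' : Ω₀ → X} {ζ ζ' : Ω₁ → X}
    (h : S.IsPushforward ξ ζ) (hξ : Measurable ξ) (hξ' : Measurable ξ') (e : ξ =ᵐ[μ] ξ')
    (e' : ζ =ᵐ[ν] ζ') : S.IsPushforward ξ' ζ' := by
  intro B hB
  filter_upwards [h B hB, e', Filter.eventuallyEq_set.1 (S.congr_toFun _ _ (hξ hB) (hξ' hB)
    (e.preimage B))] with y h1 h2 h3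
  rw [← h2, h1, h3]

theorem IsPushforward.aemeasurable {S : MeasurableSetTransformation μ ν} {ξ : Ω₀ → X}
    {ζ : Ω₁ → X} [MeasurableSpace.CountablyGenerated X] (h : S.IsPushforward ξ ζ)
    (hξ : Measurable ξ) : AEMeasurable ζ ν := by
  refine NullMeasurable.aemeasurable fun B hB => ?_
  exact (S.measurableSet_toFun _ (hξ hB)).nullMeasurableSet.congr
    (Filter.eventuallyEq_set.2 ((h B hB).mono fun y hy => hy.symm))

theorem isPushforward_indicator (S : MeasurableSetTransformation μ ν)
    (hS : ∀ᵐ y ∂ν, y ∈ S.toFun Set.univ) {A : Set Ω₀} (hA : MeasurableSet A) :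
    S.IsPushforward (A.indicator (1 : Ω₀ → ℂ)) ((S.toFun A).indicator (1 : Ω₁ → ℂ)) := by
  intro B hB
  -- The preimage depends only on which of `0` and `1` lie in `B`, which leaves four cases:
  -- everything, `A`, `Aᶜ`, nothing.
  have e2 : A.indicator (1 : Ω₀ → ℂ) ⁻¹' B = {z | z ∈ A ∧ (1 : ℂ) ∈ B ∨ z ∉ A ∧ (0 : ℂ) ∈ B} :=
    by
    ext z; by_cases hz : z ∈ A <;> simp [hz]
  rw [e2]
  have e3 := Filter.eventuallyEq_set.1 (S.compl_toFun A hA)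
  filter_upwards [e3, hS, S.empty_ae] with y h3 h4 h5
  have e1 : (S.toFun A).indicator (1 : Ω₁ → ℂ) y ∈ B ↔
      y ∈ S.toFun A ∧ (1 : ℂ) ∈ B ∨ y ∉ S.toFun A ∧ (0 : ℂ) ∈ B := by
    by_cases hz : y ∈ S.toFun A <;> simp [hz]
  rw [e1]
  by_cases h1 : (1 : ℂ) ∈ B <;> by_cases h0 : (0 : ℂ) ∈ B
  · simpa [h1, h0, em] using h4
  · simp [h1, h0]
  · have e4 : {z | z ∉ A} = Aᶜ := rfl
    simpa [h1, h0, h4, e4] using h3.symm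
  · simpa [h1, h0] using h5

theorem IsPushforward.symm {S : MeasurableSetTransformation μ ν} (hS : S.IsBijective)
    {η : Ω₁ → X} {ξ : Ω₀ → X} (h : (S.symm hS).IsPushforward η ξ) (hη : Measurable η)
    (hξ : Measurable ξ) : S.IsPushforward ξ η := by
  intro B hB
  have h1 : ξ ⁻¹' B =ᵐ[μ] S.invFun hS (η ⁻¹' B) := Filter.eventuallyEq_set.2 (h B hB)
  have h2 := S.congr_toFun _ _ (hξ hB) (S.measurableSet_invFun hS (hη hB)) h1
  filter_upwards [Filter.eventuallyEq_set.1 (h2.trans (S.toFun_invFun hS (hη hB)))] with y hy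
  exact hy.symm

/-- Take a measurable modification of `(S⁻¹)_* η`. -/
theorem exists_isPushforward {S : MeasurableSetTransformation μ ν} (hS : S.IsBijective)
    {η : Ω₁ → ℂ} (hη : Measurable η) : ∃ ξ : Ω₀ → ℂ, Measurable ξ ∧ S.IsPushforward ξ η := by
  have hu : ∀ᵐ x ∂μ, x ∈ (S.symm hS).toFun Set.univ :=
    Filter.eventuallyEq_univ.1 (hS.1 _ _ (S.measurableSet_invFun hS MeasurableSet.univ)
      MeasurableSet.univ ((S.toFun_invFun hS MeasurableSet.univ).trans
        (Filter.eventuallyEq_univ.2 (S.univ_ae_of_isSurjective hS.2)).symm))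
  have h := (S.symm hS).isPushforward_pushforward hu hη
  have hm := h.aemeasurable hη
  exact ⟨hm.mk _, hm.measurable_mk, .symm hS (h.congr hη hη .rfl hm.ae_eq_mk) hη hm.measurable_mk⟩

/-! ### Transport of measures and change of variables -/

section Measure

variable (S : MeasurableSetTransformation μ ν) (hS : S.IsBijective)

theorem pushforwardMeasure_absolutelyContinuous (κ : Measure Ω₀) (hκ : κ ≪ μ) :
    S.pushforwardMeasure hS κ hκ ≪ ν := by
  refine Measure.AbsolutelyContinuous.mk fun B hB h0 => ?_
  rw [pushforwardMeasure, pullbackMeasure, Measure.ofMeasurable_apply _ hB]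
  exact hκ (((S.symm hS).null_iff B hB).2 h0)

theorem sigmaFinite_pushforwardMeasure (κ : Measure Ω₀) (hκ : κ ≪ μ) [SigmaFinite κ] :
    SigmaFinite (S.pushforwardMeasure hS κ hκ) := by
  have hac := S.pushforwardMeasure_absolutelyContinuous hS κ hκ
  have hu : ∀ᵐ y ∂ν, ∃ n, y ∈ S.toFun (spanningSets κ n) := by
    filter_upwards [S.iUnion_ae fun n => measurableSet_spanningSets κ n,
      S.univ_ae_of_isSurjective hS.2] with y h1 h2
    rwa [← h1, iUnion_spanningSets]
  have h0 : S.pushforwardMeasure hS κ hκ (⋃ n, S.toFun (spanningSets κ n))ᶜ = 0 :=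
    hac (mem_ae_iff.1 (by simpa [Filter.Eventually, Set.ofPred_exists] using hu))
  -- The images of the spanning sets cover only up to a null set; adding that set to each makes the
  -- cover exact at no cost in measure.
  refine ⟨⟨⟨fun n => S.toFun (spanningSets κ n) ∪ (⋃ n, S.toFun (spanningSets κ n))ᶜ,
    fun n => trivial, fun n => ?_, ?_⟩⟩⟩
  · refine (measure_union_le _ _).trans_lt ?_
    rw [h0, S.pushforwardMeasure_toFun hS κ hκ (measurableSet_spanningSets κ n), add_zero]
    exact measure_spanningSets_lt_top κ n
  · rw [← Set.iUnion_union, Set.union_compl_self]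

/-- `ζ` and `ξ` have the same distribution under `S_*(κ)` and `κ`, and both integrals depend only on
it. -/
theorem IsPushforward.lintegral_pushforwardMeasure {S : MeasurableSetTransformation μ ν}
    {hS : S.IsBijective} {ξ : Ω₀ → X} {ζ : Ω₁ → X} [MeasurableSpace.CountablyGenerated X]
    (h : S.IsPushforward ξ ζ) (hξ : Measurable ξ) {φ : X → ℝ≥0∞} (hφ : Measurable φ)
    (κ : Measure Ω₀) (hκ : κ ≪ μ) :
    ∫⁻ y, φ (ζ y) ∂(S.pushforwardMeasure hS κ hκ) = ∫⁻ x, φ (ξ x) ∂κ := by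
  have hac := S.pushforwardMeasure_absolutelyContinuous hS κ hκ
  have hζ : AEMeasurable ζ (S.pushforwardMeasure hS κ hκ) := (h.aemeasurable hξ).mono_ac hac
  have e : Measure.map ζ (S.pushforwardMeasure hS κ hκ) = Measure.map ξ κ := by
    ext B hB
    rw [Measure.map_apply_of_aemeasurable hζ hB, Measure.map_apply hξ hB,
      ← S.pushforwardMeasure_toFun hS κ hκ (hξ hB)]
    exact measure_congr (hac.ae_le (Filter.eventuallyEq_set.2 (h B hB)))
  rw [← lintegral_map' hφ.aemeasurable hζ, e, lintegral_map hφ hξ]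

end Measure

end MeasurableSetTransformation

/-! ### The norm identity for a spatial system -/

namespace SpatialSystem

variable {Ω₀ Ω₁ : Type*} [MeasurableSpace Ω₀] [MeasurableSpace Ω₁]
  {μ : Measure Ω₀} {ν : Measure Ω₁} (σ : SpatialSystem μ ν)

theorem univ_ae : ∀ᵐ y ∂(ν.restrict σ.F), y ∈ σ.S.toFun Set.univ :=
  σ.S.univ_ae_of_isSurjective σ.bijective_S.2

theorem measurable_density : Measurable σ.density := Measure.measurable_rnDeriv _ _

theorem density_lt_top [SigmaFinite μ] : ∀ᵐ y ∂(ν.restrict σ.F), σ.density y < ∞ := by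
  have := σ.S.sigmaFinite_pushforwardMeasure σ.bijective_S (μ.restrict σ.E)
    Measure.AbsolutelyContinuous.rfl
  exact Measure.rnDeriv_lt_top _ _

variable [SigmaFinite μ] [SigmaFinite ν]

theorem withDensity_density : (ν.restrict σ.F).withDensity σ.density =
    σ.S.pushforwardMeasure σ.bijective_S (μ.restrict σ.E) Measure.AbsolutelyContinuous.rfl := by
  have := σ.S.sigmaFinite_pushforwardMeasure σ.bijective_S (μ.restrict σ.E)
    Measure.AbsolutelyContinuous.rfl
  exact Measure.withDensity_rnDeriv_eq _ _ (σ.S.pushforwardMeasure_absolutelyContinuous _ _ _)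

theorem lintegral_density_mul {X : Type*} [MeasurableSpace X]
    [MeasurableSpace.CountablyGenerated X] {ξ : Ω₀ → X} {ζ : Ω₁ → X}
    (h : σ.S.IsPushforward ξ ζ) (hξ : Measurable ξ) {φ : X → ℝ≥0∞} (hφ : Measurable φ) :
    ∫⁻ y in σ.F, σ.density y * φ (ζ y) ∂ν = ∫⁻ x in σ.E, φ (ξ x) ∂μ := by
  rw [← h.lintegral_pushforwardMeasure (hS := σ.bijective_S) hξ hφ (μ.restrict σ.E)
    Measure.AbsolutelyContinuous.rfl, ← σ.withDensity_density,
    lintegral_withDensity_eq_lintegral_mul₀ (g := fun y => φ (ζ y))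
      σ.measurable_density.aemeasurable (hφ.comp_aemeasurable (h.aemeasurable hξ))]
  rfl

/-- The `p`-th power turns the weight back into the density itself and removes `g`, which reduces
the claim to the change of variables. -/
theorem eLpNorm_weighted {p : ℝ≥0∞} (hp : p ≠ 0) (hp' : p ≠ ∞) {ξ : Ω₀ → ℂ} {ζ : Ω₁ → ℂ}
    (h : σ.S.IsPushforward ξ ζ) (hξ : Measurable ξ) :
    eLpNorm (fun y => (((σ.density y).toReal ^ (1 / p.toReal) : ℝ) : ℂ) * ζ y * σ.g y) p
      (ν.restrict σ.F) = eLpNorm ξ p (μ.restrict σ.E) := by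
  have hp0 : 0 < p.toReal := ENNReal.toReal_pos hp hp'
  rw [eLpNorm_eq_lintegral_rpow_enorm_toReal hp hp', eLpNorm_eq_lintegral_rpow_enorm_toReal hp hp',
    ← σ.lintegral_density_mul h hξ (φ := fun z => ‖z‖ₑ ^ p.toReal) (by fun_prop)]
  congr 1
  refine lintegral_congr_ae ?_
  filter_upwards [σ.density_lt_top, σ.norm_g] with y h1 h2
  have h3 : ‖σ.g y‖ₑ = 1 := by rw [← ofReal_norm, h2, ENNReal.ofReal_one]
  rw [enorm_mul, enorm_mul, h3, mul_one, ENNReal.mul_rpow_of_nonneg _ _ hp0.le]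
  congr 1
  rw [← ofReal_norm, Complex.norm_real, Real.norm_of_nonneg (by positivity),
    ← ENNReal.ofReal_rpow_of_nonneg ENNReal.toReal_nonneg (by positivity),
    ENNReal.ofReal_toReal h1.ne, ← ENNReal.rpow_mul, one_div_mul_cancel hp0.ne', ENNReal.rpow_one]

end SpatialSystem

/-! ### Multiplication by characteristic functions -/

namespace MeasureTheory.Lp

variable {Ω : Type*} [MeasurableSpace Ω] {μ : Measure Ω} {p : ℝ≥0∞}

theorem enorm_rpow_toReal (hp : p ≠ 0) (hp' : p ≠ ∞) (x : Lp ℂ p μ) :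
    ‖x‖ₑ ^ p.toReal = ∫⁻ a, ‖x a‖ₑ ^ p.toReal ∂μ := by
  have hp0 : p.toReal ≠ 0 := (ENNReal.toReal_pos hp hp').ne'
  rw [Lp.enorm_def, eLpNorm_eq_lintegral_rpow_enorm_toReal hp hp', ← ENNReal.rpow_mul,
    one_div_mul_cancel hp0, ENNReal.rpow_one]

theorem coeFn_toLp_indicator {A : Set Ω} (hA : MeasurableSet A) (x : Lp ℂ p μ) :
    (((Lp.memLp x).indicator hA).toLp : Lp ℂ p μ) =ᵐ[μ] A.indicator x :=
  ((Lp.memLp x).indicator hA).coeFn_toLp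

/-- Multiplication by the characteristic function of a measurable set, as a linear map on `L^p`. -/
noncomputable def indicatorLinearMap (p : ℝ≥0∞) (μ : Measure Ω) {A : Set Ω}
    (hA : MeasurableSet A) : Lp ℂ p μ →ₗ[ℂ] Lp ℂ p μ where
  toFun x := ((Lp.memLp x).indicator hA).toLp
  map_add' x y := by
    rw [← MemLp.toLp_add, MemLp.toLp_eq_toLp_iff, ← Set.indicator_add']
    filter_upwards [Lp.coeFn_add x y] with a h
    by_cases ha : a ∈ A
    · rw [Set.indicator_of_mem ha, Set.indicator_of_mem ha, h]
    · rw [Set.indicator_of_notMem ha, Set.indicator_of_notMem ha]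
  map_smul' c x := by
    rw [RingHom.id_apply, ← MemLp.toLp_const_smul, MemLp.toLp_eq_toLp_iff]
    filter_upwards [Lp.coeFn_smul c x] with a h
    rw [Pi.smul_apply]
    by_cases ha : a ∈ A
    · rw [Set.indicator_of_mem ha, Set.indicator_of_mem ha, h, Pi.smul_apply]
    · rw [Set.indicator_of_notMem ha, Set.indicator_of_notMem ha, smul_zero]

variable [Fact (1 ≤ p)]

/-- Multiplication by the characteristic function of a measurable set on `L^p`. -/
noncomputable def indicatorCLM (p : ℝ≥0∞) [Fact (1 ≤ p)] (μ : Measure Ω) {A : Set Ω}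
    (hA : MeasurableSet A) : Lp ℂ p μ →L[ℂ] Lp ℂ p μ :=
  (indicatorLinearMap p μ hA).mkContinuous 1 fun x => by
    rw [one_mul]
    refine Lp.norm_le_norm_of_ae_le ?_
    filter_upwards [coeFn_toLp_indicator hA x] with a h1
    exact (congrArg norm h1).trans_le (norm_indicator_le_norm_self _ _)

variable {A : Set Ω} (hA : MeasurableSet A)

theorem coeFn_indicatorCLM (x : Lp ℂ p μ) : indicatorCLM p μ hA x =ᵐ[μ] A.indicator x :=
  ((Lp.memLp x).indicator hA).coeFn_toLp

theorem norm_indicatorCLM_le : ‖indicatorCLM p μ hA‖ ≤ 1 :=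
  LinearMap.mkContinuous_norm_le _ zero_le_one _

theorem norm_indicatorCLM_apply_le (x : Lp ℂ p μ) : ‖indicatorCLM p μ hA x‖ ≤ ‖x‖ := by
  simpa using (indicatorCLM p μ hA).le_of_opNorm_le (norm_indicatorCLM_le hA) x

theorem indicatorCLM_apply_apply (x : Lp ℂ p μ) :
    indicatorCLM p μ hA (indicatorCLM p μ hA x) = indicatorCLM p μ hA x := by
  refine Lp.ext ?_
  filter_upwards [coeFn_indicatorCLM hA x, coeFn_indicatorCLM hA (indicatorCLM p μ hA x)]
    with a h1 h2
  rw [h2]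
  by_cases ha : a ∈ A <;> simp [ha, h1]

theorem isIdempotentElem_indicatorCLM : IsIdempotentElem (indicatorCLM p μ hA) :=
  ContinuousLinearMap.ext (indicatorCLM_apply_apply hA)

theorem enorm_indicatorCLM_apply (x : Lp ℂ p μ) :
    ‖indicatorCLM p μ hA x‖ₑ = eLpNorm x p (μ.restrict A) := by
  rw [Lp.enorm_def, eLpNorm_congr_ae (coeFn_indicatorCLM hA x),
    eLpNorm_indicator_eq_eLpNorm_restrict hA]

/-- Disjointness of supports gives `‖x‖^p = ‖χ_A x‖^p + ‖x - χ_A x‖^p`, so equal norms leave nothing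
off `A`. -/
theorem indicatorCLM_eq_self_of_norm_eq (hp' : p ≠ ∞) {x : Lp ℂ p μ}
    (h : ‖indicatorCLM p μ hA x‖ = ‖x‖) : indicatorCLM p μ hA x = x := by
  have hp : p ≠ 0 := (zero_lt_one.trans_le Fact.out).ne'
  have hp0 : 0 < p.toReal := ENNReal.toReal_pos hp hp'
  have h1 : ‖x‖ₑ ^ p.toReal =
      ‖indicatorCLM p μ hA x‖ₑ ^ p.toReal + ‖x - indicatorCLM p μ hA x‖ₑ ^ p.toReal := by
    rw [enorm_rpow_toReal hp hp', enorm_rpow_toReal hp hp', enorm_rpow_toReal hp hp',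
      ← lintegral_add_left' ((Lp.aestronglyMeasurable _).enorm.pow_const _)]
    refine lintegral_congr_ae ?_
    filter_upwards [coeFn_indicatorCLM hA x, Lp.coeFn_sub x (indicatorCLM p μ hA x)] with a h1 h2
    rw [h2, Pi.sub_apply, h1]
    by_cases ha : a ∈ A <;> simp [ha, hp0]
  have h2 : ‖indicatorCLM p μ hA x‖ₑ = ‖x‖ₑ := by rw [← ofReal_norm, h, ofReal_norm]
  rw [h2] at h1
  have h3 : ‖x - indicatorCLM p μ hA x‖ₑ ^ p.toReal = 0 :=
    (ENNReal.add_right_inj (ENNReal.rpow_ne_top_of_nonneg hp0.le enorm_ne_top)).1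
      (h1.symm.trans (add_zero _).symm)
  rw [ENNReal.rpow_eq_zero_iff_of_pos hp0, enorm_eq_zero, sub_eq_zero] at h3
  exact h3.symm

end MeasureTheory.Lp

/-- A bounded idempotent with the same seminorm `‖e x‖ = ‖χ_A x‖` as the multiplication by a
characteristic function is this multiplication. -/
theorem IsIdempotentElem.eq_indicatorCLM {Ω : Type*} [MeasurableSpace Ω] {μ : Measure Ω}
    {p : ℝ≥0∞} [Fact (1 ≤ p)] (hp' : p ≠ ∞) {A : Set Ω} (hA : MeasurableSet A)
    {e : Lp ℂ p μ →L[ℂ] Lp ℂ p μ} (he : IsIdempotentElem e)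
    (h : ∀ x, ‖e x‖ = ‖Lp.indicatorCLM p μ hA x‖) : e = Lp.indicatorCLM p μ hA := by
  ext1 x
  have h1 : e (e x) = e x := DFunLike.congr_fun he x
  -- The range of `e` is supported in `A`. Moreover `e x - x` lies in the kernel of `e`, which is
  -- the kernel of multiplication by `χ_A`; hence `χ_A x = χ_A (e x) = e x`.
  have h2 : Lp.indicatorCLM p μ hA (e x) = e x :=
    Lp.indicatorCLM_eq_self_of_norm_eq hA hp' (by rw [← h, h1])
  have h3 := h (e x - x)
  rw [map_sub, h1, sub_self, norm_zero, eq_comm, norm_eq_zero, map_sub, sub_eq_zero, h2] at h3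
  exact h3

/-! ### Support and range of the operator of a spatial system -/

namespace SpatialSystem

variable {Ω₀ Ω₁ : Type*} [MeasurableSpace Ω₀] [MeasurableSpace Ω₁]
  {μ : Measure Ω₀} {ν : Measure Ω₁}

/-- The function `(dS_*(μ|_E)/dν|_F)^{1/p} S_*(ξ|_E) g` on `F`, extended by zero. -/
noncomputable def weighted (σ : SpatialSystem μ ν) (p : ℝ≥0∞) (ξ : Ω₀ → ℂ) : Ω₁ → ℂ :=
  σ.F.indicator fun y =>
    (((σ.density y).toReal ^ (1 / p.toReal) : ℝ) : ℂ) * σ.S.pushforward ξ y * σ.g y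

theorem isPushforward (σ : SpatialSystem μ ν) {ξ : Ω₀ → ℂ} (hξ : Measurable ξ) :
    σ.S.IsPushforward ξ (σ.S.pushforward ξ) :=
  σ.S.isPushforward_pushforward σ.univ_ae hξ

/-- The zero set of the density is null for `S_*(μ|_E)`, and `S⁻¹` reflects null sets. This permits
division by the weight. -/
theorem density_ne_zero [SigmaFinite μ] [SigmaFinite ν] (σ : SpatialSystem μ ν) :
    ∀ᵐ y ∂(ν.restrict σ.F), σ.density y ≠ 0 := by
  have hm : MeasurableSet {y | σ.density y = 0} := σ.measurable_density (measurableSet_singleton 0)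
  have h0 : (ν.restrict σ.F).withDensity σ.density {y | σ.density y = 0} = 0 := by
    rw [withDensity_apply _ hm]
    exact (setLIntegral_congr_fun hm fun y hy => hy).trans (by simp)
  rw [σ.withDensity_density, MeasurableSetTransformation.pushforwardMeasure,
    MeasurableSetTransformation.pullbackMeasure, Measure.ofMeasurable_apply _ hm,
    (σ.S.symm σ.bijective_S).null_iff _ hm] at h0
  exact measure_eq_zero_iff_ae_notMem.1 h0

variable {p : ℝ≥0∞} [Fact (1 ≤ p)]

theorem indicatorCLM_apply (σ : SpatialSystem μ ν) {s : Lp ℂ p μ → Lp ℂ p ν}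
    (hs : ∀ ξ : Lp ℂ p μ, s ξ =ᵐ[ν] σ.weighted p ξ) (ξ : Lp ℂ p μ) :
    Lp.indicatorCLM p ν σ.measurableSet_F (s ξ) = s ξ := by
  refine Lp.ext ?_
  filter_upwards [Lp.coeFn_indicatorCLM σ.measurableSet_F (s ξ), hs ξ] with y h1 h2
  rw [h1, h2]
  by_cases hy : y ∈ σ.F <;> simp [hy, h2, weighted]

variable [SigmaFinite μ] [SigmaFinite ν]

theorem eLpNorm_weighted' (σ : SpatialSystem μ ν) (hp' : p ≠ ∞) {ξ : Ω₀ → ℂ} (hξ : Measurable ξ) :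
    eLpNorm (σ.weighted p ξ) p ν = eLpNorm ξ p (μ.restrict σ.E) := by
  have hp : p ≠ 0 := (zero_lt_one.trans_le Fact.out).ne'
  rw [weighted, eLpNorm_indicator_eq_eLpNorm_restrict σ.measurableSet_F,
    σ.eLpNorm_weighted hp hp' (σ.isPushforward hξ) hξ]

theorem norm_apply (σ : SpatialSystem μ ν) (hp' : p ≠ ∞) {s : Lp ℂ p μ → Lp ℂ p ν}
    (hs : ∀ ξ : Lp ℂ p μ, s ξ =ᵐ[ν] σ.weighted p ξ) (ξ : Lp ℂ p μ) :
    ‖s ξ‖ = ‖Lp.indicatorCLM p μ σ.measurableSet_E ξ‖ := by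
  have h : ‖s ξ‖ₑ = ‖Lp.indicatorCLM p μ σ.measurableSet_E ξ‖ₑ := by
    rw [Lp.enorm_indicatorCLM_apply, Lp.enorm_def, eLpNorm_congr_ae (hs ξ),
      σ.eLpNorm_weighted' hp' (Lp.stronglyMeasurable ξ).measurable]
  rw [← toReal_enorm, h, toReal_enorm]

/-- Divide `η` by weight and phase on `F` and pull back along `S⁻¹`; the norm identity, read
backwards, puts the result in `L^p`. -/
theorem exists_apply_eq (σ : SpatialSystem μ ν) (hp' : p ≠ ∞) {s : Lp ℂ p μ → Lp ℂ p ν}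
    (hs : ∀ ξ : Lp ℂ p μ, s ξ =ᵐ[ν] σ.weighted p ξ) (η : Lp ℂ p ν) :
    ∃ ξ, s ξ = Lp.indicatorCLM p ν σ.measurableSet_F η := by
  have hp : p ≠ 0 := (zero_lt_one.trans_le Fact.out).ne'
  let c : Ω₁ → ℂ := fun y => (((σ.density y).toReal ^ (1 / p.toReal) : ℝ) : ℂ)
  have hc : Measurable c := Complex.measurable_ofReal.comp
    (σ.measurable_density.ennreal_toReal.pow_const _)
  have hη : Measurable η := (Lp.stronglyMeasurable η).measurable
  let ζ : Ω₁ → ℂ := fun y => η y / (c y * σ.g y)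
  have hζ : Measurable ζ := hη.div (hc.mul σ.measurable_g)
  have hcζ : ∀ᵐ y ∂(ν.restrict σ.F), c y * ζ y * σ.g y = η y := by
    filter_upwards [σ.density_ne_zero, σ.density_lt_top, σ.norm_g] with y h1 h2 h3
    have h4 : c y ≠ 0 :=
      Complex.ofReal_ne_zero.2 (Real.rpow_pos_of_pos (ENNReal.toReal_pos h1 h2.ne) _).ne'
    have h5 : σ.g y ≠ 0 := by
      intro h; simp [h] at h3
    simp only [ζ]
    field_simp
  obtain ⟨ξ, hξ, h⟩ := MeasurableSetTransformation.exists_isPushforward σ.bijective_S hζ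
  have h1 : eLpNorm ξ p (μ.restrict σ.E) = eLpNorm η p (ν.restrict σ.F) := by
    rw [← σ.eLpNorm_weighted hp hp' h hξ]
    exact eLpNorm_congr_ae hcζ
  have hmem : MemLp (σ.E.indicator ξ) p μ := by
    refine ⟨(hξ.indicator σ.measurableSet_E).aestronglyMeasurable, ?_⟩
    rw [eLpNorm_indicator_eq_eLpNorm_restrict σ.measurableSet_E, h1]
    exact (eLpNorm_mono_measure _ Measure.restrict_le_self).trans_lt (Lp.eLpNorm_lt_top η)
  have hm : Measurable (hmem.toLp : Lp ℂ p μ) := (Lp.stronglyMeasurable _).measurable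
  have h2 : ξ =ᵐ[μ.restrict σ.E] (hmem.toLp : Lp ℂ p μ) :=
    (indicator_ae_eq_restrict σ.measurableSet_E).symm.trans
      (Filter.EventuallyEq.symm (ae_restrict_of_ae hmem.coeFn_toLp))
  have h3 := (σ.isPushforward hm).ae_eq (h.congr hξ hm h2 .rfl)
  refine ⟨hmem.toLp, ?_⟩
  refine Lp.ext ?_
  filter_upwards [hs hmem.toLp, Lp.coeFn_indicatorCLM σ.measurableSet_F η,
    (ae_restrict_iff' σ.measurableSet_F).1 h3, (ae_restrict_iff' σ.measurableSet_F).1 hcζ]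
    with y h4 h5 h6 h7
  rw [h4, h5, weighted]
  by_cases hy : y ∈ σ.F
  · simp only [Set.indicator_of_mem hy]
    rw [h6 hy, h7 hy]
  · simp [hy]

/-- The spatial system of the multiplication by `χ_A`. -/
noncomputable def ofSet (μ : Measure Ω₀) {A : Set Ω₀} (hA : MeasurableSet A) :
    SpatialSystem μ μ where
  E := A
  F := A
  measurableSet_E := hA
  measurableSet_F := hA
  S :=
    { toFun := id
      measurableSet_toFun := fun _ h => h
      congr_toFun := fun _ _ _ _ h => h
      null_iff := fun _ _ => Iff.rfl
      compl_toFun := fun B _ => by rw [id, id, id, Set.compl_eq_univ_sdiff]; rfl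
      iUnion_toFun := fun _ _ _ => .rfl }
  bijective_S := ⟨fun _ _ _ _ h => h, fun B hB => ⟨B, hB, .rfl⟩⟩
  g := 1
  measurable_g := measurable_const
  norm_g := by simp

end SpatialSystem

/-! ### From a spatial partial isometry to its partial inverse -/

theorem isSpatialPartialIsometry_indicatorCLM {Ω : Type*} [MeasurableSpace Ω] {μ : Measure Ω}
    [SigmaFinite μ] {p : ℝ≥0∞} [Fact (1 ≤ p)] {A : Set Ω} (hA : MeasurableSet A) :
    IsSpatialPartialIsometry (Lp.indicatorCLM p μ hA : Lp ℂ p μ →ₗ[ℂ] Lp ℂ p μ) := by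
  refine ⟨SpatialSystem.ofSet μ hA, fun ξ => ?_⟩
  set σ := SpatialSystem.ofSet μ hA
  have hP : σ.S.pushforwardMeasure σ.bijective_S (μ.restrict σ.E)
      Measure.AbsolutelyContinuous.rfl = μ.restrict A := by
    ext B hB
    exact σ.S.pushforwardMeasure_toFun σ.bijective_S (μ.restrict σ.E) _ hB
  have h1 : σ.density =ᵐ[μ.restrict A] fun _ => 1 := by
    rw [SpatialSystem.density, hP]
    exact Measure.rnDeriv_self _
  have h2 : σ.S.pushforward ξ =ᵐ[μ.restrict A] ξ := by
    refine (σ.isPushforward (Lp.stronglyMeasurable ξ).measurable).ae_eq fun B _ => ?_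
    exact Filter.Eventually.of_forall fun y => Iff.rfl
  filter_upwards [Lp.coeFn_indicatorCLM hA ξ, (ae_restrict_iff' hA).1 h1,
    (ae_restrict_iff' hA).1 h2] with y h3 h4 h5
  rw [ContinuousLinearMap.coe_coe, h3]
  by_cases hy : y ∈ A
  · have hy' : y ∈ σ.F := hy
    rw [Set.indicator_of_mem hy, Set.indicator_of_mem hy', h4 hy, h5 hy]
    simp [σ, SpatialSystem.ofSet]
  · have hy' : y ∉ σ.F := hy
    rw [Set.indicator_of_notMem hy, Set.indicator_of_notMem hy']

/-- A partial isometry of normed spaces with initial projection `e` and final projection `f` has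
a contractive partial inverse. -/
theorem ContinuousLinearMap.exists_partial_inverse {X Y : Type*} [NormedAddCommGroup X]
    [NormedSpace ℂ X] [NormedAddCommGroup Y] [NormedSpace ℂ Y] (s : X →L[ℂ] Y) (e : X →L[ℂ] X)
    (f : Y →L[ℂ] Y) (he : ∀ x, e (e x) = e x) (hf : ∀ y, ‖f y‖ ≤ ‖y‖) (hs : ∀ x, ‖s x‖ = ‖e x‖)
    (hfs : ∀ x, f (s x) = s x) (hsurj : ∀ y, ∃ x, s x = f y) :
    ∃ t : Y →L[ℂ] X, (∀ y, s (t y) = f y) ∧ (∀ x, t (s x) = e x) ∧ (∀ y, e (t y) = t y) ∧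
      (∀ y, t (f y) = t y) ∧ ‖t‖ ≤ 1 := by
  choose r hr using hsurj
  -- The preimages `r y` are arbitrary, but `e (r y)` does not depend on the choice; this is what
  -- makes `y ↦ e (r y)` linear.
  have key : ∀ x x', s x = s x' → e x = e x' := by
    intro x x' h
    rw [← sub_eq_zero, ← map_sub, ← norm_eq_zero, ← hs, map_sub, h, sub_self, norm_zero]
  have hse : ∀ x, s (e x) = s x := by
    intro x
    rw [← sub_eq_zero, ← map_sub, ← norm_eq_zero, hs, map_sub, he, sub_self, norm_zero]
  let t : Y →L[ℂ] X := LinearMap.mkContinuous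
    { toFun := fun y => e (r y)
      map_add' := fun y y' => by
        rw [← map_add]
        exact key _ _ (by rw [map_add, hr, hr, hr, map_add])
      map_smul' := fun c y => by
        rw [RingHom.id_apply, ← map_smul]
        exact key _ _ (by rw [map_smul, hr, hr, map_smul]) }
    1 (fun y => by
      rw [one_mul]
      exact ((hs (r y)).symm.trans (congrArg norm (hr y))).trans_le (hf y))
  have ht : ∀ y, t y = e (r y) := fun y => rfl
  have hff : ∀ y, f (f y) = f y := fun y => by rw [← hr y, hfs]
  refine ⟨t, fun y => ?_, fun x => ?_, fun y => ?_, fun y => ?_,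
    LinearMap.mkContinuous_norm_le _ zero_le_one _⟩
  · rw [ht, hse, hr]
  · rw [ht]
    exact key _ _ (by rw [hr, hfs])
  · rw [ht, he]
  · rw [ht, ht]
    exact key _ _ (by rw [hr, hr, hff])

theorem IsSpatialPartialIsometry.exists_partial_inverse {Ω : Type*} [MeasurableSpace Ω]
    {μ : Measure Ω} [SigmaFinite μ] {p : ℝ≥0∞} [Fact (1 ≤ p)] (hp_top : p ≠ ∞)
    {s : Lp ℂ p μ →L[ℂ] Lp ℂ p μ}
    (h : IsSpatialPartialIsometry (s : Lp ℂ p μ →ₗ[ℂ] Lp ℂ p μ)) :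
    ∃ t e f : Lp ℂ p μ →L[ℂ] Lp ℂ p μ,
        IsIdempotentElem e ∧ IsIdempotentElem f ∧
        IsSpatialPartialIsometry (e : Lp ℂ p μ →ₗ[ℂ] Lp ℂ p μ) ∧
        IsSpatialPartialIsometry (f : Lp ℂ p μ →ₗ[ℂ] Lp ℂ p μ) ∧
        s * t = f ∧ t * s = e ∧
        f * s * e = s ∧ e * t * f = t ∧
        ‖s‖ ≤ 1 ∧ ‖t‖ ≤ 1 := by
  obtain ⟨σ, hσ⟩ := h
  have h1 := σ.norm_apply hp_top hσ
  have h2 := σ.indicatorCLM_apply hσ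
  obtain ⟨t, ht1, ht2, ht3, ht4, ht5⟩ := s.exists_partial_inverse
    (Lp.indicatorCLM p μ σ.measurableSet_E) (Lp.indicatorCLM p μ σ.measurableSet_F)
    (Lp.indicatorCLM_apply_apply _) (Lp.norm_indicatorCLM_apply_le _) h1 h2
    (σ.exists_apply_eq hp_top hσ)
  refine ⟨t, _, _, Lp.isIdempotentElem_indicatorCLM σ.measurableSet_E,
    Lp.isIdempotentElem_indicatorCLM σ.measurableSet_F,
    isSpatialPartialIsometry_indicatorCLM _, isSpatialPartialIsometry_indicatorCLM _,
    ContinuousLinearMap.ext ht1, ContinuousLinearMap.ext ht2, ContinuousLinearMap.ext fun x => ?_,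
    ContinuousLinearMap.ext fun x => ?_, ?_, ht5⟩
  · change Lp.indicatorCLM p μ σ.measurableSet_F (s (Lp.indicatorCLM p μ σ.measurableSet_E x)) = _
    have h3 := h2 (Lp.indicatorCLM p μ σ.measurableSet_E x)
    rw [ContinuousLinearMap.coe_coe] at h3
    -- Here `s e = s t s = f s = s`.
    rw [h3, ← ht2, ht1]
    exact h2 x
  · change Lp.indicatorCLM p μ σ.measurableSet_E (t (Lp.indicatorCLM p μ σ.measurableSet_F x)) = _
    rw [ht3, ht4]
  · refine s.opNorm_le_bound zero_le_one fun x => ?_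
    rw [one_mul]
    exact (h1 x).trans_le (Lp.norm_indicatorCLM_apply_le _ x)

/-! ### Clarkson's inequality and its equality case -/

/-- In `(x + y)^q = x (x + y)^(q-1) + y (x + y)^(q-1)`, the factor `a ↦ a^(q-1)` is strictly
increasing; for `q < 1` it is strictly decreasing and the inequality reverses. -/
theorem Real.rpow_add_rpow_lt_add_rpow {q x y : ℝ} (hq : 1 < q) (hx : 0 < x) (hy : 0 < y) :
    x ^ q + y ^ q < (x + y) ^ q := by
  have key : ∀ a : ℝ, 0 < a → a ^ q = a * a ^ (q - 1) := fun a ha => by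
    rw [← Real.rpow_one_add' ha.le (by linarith), add_sub_cancel]
  rw [key x hx, key y hy, key (x + y) (by positivity), add_mul]
  gcongr <;> linarith

theorem Real.add_rpow_lt_rpow_add_rpow {q x y : ℝ} (hq0 : 0 < q) (hq : q < 1) (hx : 0 < x)
    (hy : 0 < y) : (x + y) ^ q < x ^ q + y ^ q := by
  have key : ∀ a : ℝ, 0 < a → a ^ q = a * a ^ (q - 1) := fun a ha => by
    rw [← Real.rpow_one_add' ha.le (by linarith), add_sub_cancel]
  rw [key x hx, key y hy, key (x + y) (by positivity), add_mul]
  refine add_lt_add ?_ ?_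
  · exact mul_lt_mul_of_pos_left (Real.rpow_lt_rpow_of_neg hx (by linarith) (by linarith)) hx
  · exact mul_lt_mul_of_pos_left (Real.rpow_lt_rpow_of_neg hy (by linarith) (by linarith)) hy

namespace Complex

theorem norm_rpow_eq_sq_rpow (z : ℂ) (P : ℝ) : ‖z‖ ^ P = (‖z‖ ^ 2) ^ (P / 2) := by
  rw [← Real.rpow_natCast, ← Real.rpow_mul (norm_nonneg z)]
  congr 1
  push_cast
  ring

/-- Clarkson's inequality for scalars, `2 < P`, with its equality case. -/
theorem two_mul_rpow_add_rpow_lt {P : ℝ} (hP : 2 < P) {z w : ℂ} (hz : z ≠ 0) (hw : w ≠ 0) :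
    2 * (‖z‖ ^ P + ‖w‖ ^ P) < ‖z + w‖ ^ P + ‖z - w‖ ^ P := by
  simp only [norm_rpow_eq_sq_rpow]
  -- By the parallelogram law `‖z‖² + ‖w‖²` is the mean of `‖z ± w‖²`. Convexity of `t ↦ t^(P/2)`
  -- compares the powers with the mean, and superadditivity supplies the strictness.
  have h := parallelogram_law_with_norm ℝ z w
  have hx : 0 < ‖z‖ ^ 2 := by positivity
  have hy : 0 < ‖w‖ ^ 2 := by positivity
  have h1 := Real.rpow_add_rpow_lt_add_rpow (q := P / 2) (by linarith) hx hy
  have h2 := (convexOn_rpow (p := P / 2) (by linarith)).2 (sq_nonneg ‖z + w‖)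
    (sq_nonneg ‖z - w‖) one_half_pos.le one_half_pos.le (add_halves 1)
  simp only [smul_eq_mul] at h2
  rw [show 1 / 2 * (‖z + w‖ ^ 2) + 1 / 2 * (‖z - w‖ ^ 2) =
    ‖z‖ ^ 2 + ‖w‖ ^ 2 by linarith] at h2
  linarith

/-- Clarkson's inequality for scalars, `0 < P < 2`, with its equality case. -/
theorem rpow_add_rpow_lt_two_mul {P : ℝ} (hP0 : 0 < P) (hP : P < 2) {z w : ℂ} (hz : z ≠ 0)
    (hw : w ≠ 0) : ‖z + w‖ ^ P + ‖z - w‖ ^ P < 2 * (‖z‖ ^ P + ‖w‖ ^ P) := by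
  simp only [norm_rpow_eq_sq_rpow]
  have h := parallelogram_law_with_norm ℝ z w
  have hx : 0 < ‖z‖ ^ 2 := by positivity
  have hy : 0 < ‖w‖ ^ 2 := by positivity
  have h1 := Real.add_rpow_lt_rpow_add_rpow (q := P / 2) (by linarith) (by linarith) hx hy
  have h2 := (Real.concaveOn_rpow (p := P / 2) (by linarith) (by linarith)).2
    (sq_nonneg ‖z + w‖)
    (sq_nonneg ‖z - w‖) one_half_pos.le one_half_pos.le (add_halves 1)
  simp only [smul_eq_mul] at h2
  rw [show 1 / 2 * (‖z + w‖ ^ 2) + 1 / 2 * (‖z - w‖ ^ 2) =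
    ‖z‖ ^ 2 + ‖w‖ ^ 2 by linarith] at h2
  linarith

theorem clarkson_eq_of_disjoint {P : ℝ} (hP : 0 < P) {z w : ℂ} (h : z = 0 ∨ w = 0) :
    ‖z + w‖ ^ P + ‖z - w‖ ^ P = 2 * (‖z‖ ^ P + ‖w‖ ^ P) := by
  rcases h with rfl | rfl
  · simp [Real.zero_rpow hP.ne', two_mul]
  · simp [Real.zero_rpow hP.ne', two_mul]

end Complex

namespace MeasureTheory.Lp

variable {Ω : Type*} [MeasurableSpace Ω] {μ : Measure Ω} {p : ℝ≥0∞}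

theorem norm_rpow_toReal (hp : p ≠ 0) (hp' : p ≠ ∞) (x : Lp ℂ p μ) :
    ‖x‖ ^ p.toReal = ∫ a, ‖x a‖ ^ p.toReal ∂μ := by
  have hp0 : p.toReal ≠ 0 := (ENNReal.toReal_pos hp hp').ne'
  have h0 : 0 ≤ ∫ a, ‖x a‖ ^ p.toReal ∂μ := integral_nonneg fun a => by positivity
  rw [Lp.norm_def, (Lp.memLp x).eLpNorm_eq_integral_rpow_norm hp hp',
    ENNReal.toReal_ofReal (by positivity), ← Real.rpow_mul h0, inv_mul_cancel₀ hp0, Real.rpow_one]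

theorem integrable_norm_rpow_toReal (hp : p ≠ 0) (hp' : p ≠ ∞) (x : Lp ℂ p μ) :
    Integrable (fun a => ‖x a‖ ^ p.toReal) μ :=
  (Lp.memLp x).integrable_norm_rpow hp hp'

/-- For `p ≠ 2`, equality holds in Clarkson's inequality for functions with disjoint supports
only. -/
theorem clarkson_eq_iff (hp : p ≠ 0) (hp' : p ≠ ∞) (hp2 : p ≠ 2) (x y : Lp ℂ p μ) :
    ‖x + y‖ ^ p.toReal + ‖x - y‖ ^ p.toReal = 2 * (‖x‖ ^ p.toReal + ‖y‖ ^ p.toReal) ↔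
      ∀ᵐ a ∂μ, x a = 0 ∨ y a = 0 := by
  have hP : 0 < p.toReal := ENNReal.toReal_pos hp hp'
  have hP2 : p.toReal ≠ 2 := fun h => hp2 (by
    rw [← ENNReal.ofReal_toReal hp', h]; simp)
  let L : Ω → ℝ := fun a => ‖x a + y a‖ ^ p.toReal + ‖x a - y a‖ ^ p.toReal
  let R : Ω → ℝ := fun a => 2 * (‖x a‖ ^ p.toReal + ‖y a‖ ^ p.toReal)
  have e1 : (fun a => ‖(x + y) a‖ ^ p.toReal + ‖(x - y) a‖ ^ p.toReal) =ᵐ[μ] L := by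
    filter_upwards [Lp.coeFn_add x y, Lp.coeFn_sub x y] with a h1 h2
    rw [h1, h2]; rfl
  have i1 := (integrable_norm_rpow_toReal hp hp' (x + y)).add
    (integrable_norm_rpow_toReal hp hp' (x - y))
  have iL : Integrable L μ := i1.congr e1
  have iR : Integrable R μ := ((integrable_norm_rpow_toReal hp hp' x).add
    (integrable_norm_rpow_toReal hp hp' y)).const_mul 2
  have hL : ‖x + y‖ ^ p.toReal + ‖x - y‖ ^ p.toReal = ∫ a, L a ∂μ := by
    rw [norm_rpow_toReal hp hp', norm_rpow_toReal hp hp',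
      ← integral_add (integrable_norm_rpow_toReal hp hp' _) (integrable_norm_rpow_toReal hp hp' _)]
    exact integral_congr_ae e1
  have hR : 2 * (‖x‖ ^ p.toReal + ‖y‖ ^ p.toReal) = ∫ a, R a ∂μ := by
    rw [norm_rpow_toReal hp hp', norm_rpow_toReal hp hp',
      ← integral_add (integrable_norm_rpow_toReal hp hp' _) (integrable_norm_rpow_toReal hp hp' _),
      ← integral_const_mul]
  have hpt : L =ᵐ[μ] R ↔ ∀ᵐ a ∂μ, x a = 0 ∨ y a = 0 := by
    refine Filter.eventually_congr (Filter.Eventually.of_forall fun a => ?_)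
    refine ⟨fun h => ?_, fun h => Complex.clarkson_eq_of_disjoint hP h⟩
    by_contra! hxy
    rcases lt_or_gt_of_ne hP2 with h2 | h2
    · exact (Complex.rpow_add_rpow_lt_two_mul hP h2 hxy.1 hxy.2).ne h
    · exact (Complex.two_mul_rpow_add_rpow_lt h2 hxy.1 hxy.2).ne' h
  rw [hL, hR, ← hpt]
  -- The pointwise inequality has a constant sign, depending on the side of `2` on which `p` lies,
  -- so equal integrals mean equality almost everywhere.
  rcases lt_or_gt_of_ne hP2 with h2 | h2
  · refine integral_eq_iff_of_ae_le iL iR (Filter.Eventually.of_forall fun a => ?_)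
    by_cases h : x a = 0 ∨ y a = 0
    · exact (Complex.clarkson_eq_of_disjoint hP h).le
    · push Not at h
      exact (Complex.rpow_add_rpow_lt_two_mul hP h2 h.1 h.2).le
  · rw [eq_comm, Filter.eventuallyEq_comm]
    refine integral_eq_iff_of_ae_le iR iL (Filter.Eventually.of_forall fun a => ?_)
    by_cases h : x a = 0 ∨ y a = 0
    · exact (Complex.clarkson_eq_of_disjoint hP h).ge
    · push Not at h
      exact (Complex.two_mul_rpow_add_rpow_lt h2 h.1 h.2).le

variable [Fact (1 ≤ p)]

/-- A linear map which is isometric up to a characteristic function preserves disjointness. -/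
theorem disjoint_apply_of_norm_eq {Ω' : Type*} [MeasurableSpace Ω'] {ν : Measure Ω'}
    (hp' : p ≠ ∞) (hp2 : p ≠ 2) {E : Set Ω} (hE : MeasurableSet E) {s : Lp ℂ p μ →L[ℂ] Lp ℂ p ν}
    (hs : ∀ x, ‖s x‖ = ‖indicatorCLM p μ hE x‖) {x y : Lp ℂ p μ}
    (h : ∀ᵐ a ∂μ, x a = 0 ∨ y a = 0) : ∀ᵐ b ∂ν, s x b = 0 ∨ s y b = 0 := by
  have hp : p ≠ 0 := (zero_lt_one.trans_le Fact.out).ne'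
  -- Clarkson's equality involves only norms of linear combinations, so it passes between `s x, s y`
  -- and `χ_E x, χ_E y`.
  rw [← clarkson_eq_iff hp hp' hp2, ← map_add, ← map_sub, hs, hs, hs, hs, map_add, map_sub,
    clarkson_eq_iff hp hp' hp2]
  filter_upwards [h, coeFn_indicatorCLM hE x, coeFn_indicatorCLM hE y] with a h1 h2 h3
  rw [h2, h3]
  exact h1.imp (fun h => Set.indicator_apply_eq_zero.2 fun _ => h)
    (fun h => Set.indicator_apply_eq_zero.2 fun _ => h)

theorem tendsto_of_dominated (hp' : p ≠ ∞) {f : ℕ → Lp ℂ p μ} {x g : Lp ℂ p μ}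
    (hb : ∀ n, ∀ᵐ a ∂μ, ‖f n a‖ ≤ ‖g a‖)
    (h : ∀ᵐ a ∂μ, Filter.Tendsto (fun n => f n a) Filter.atTop (nhds (x a))) :
    Filter.Tendsto f Filter.atTop (nhds x) := by
  have hp : p ≠ 0 := (zero_lt_one.trans_le Fact.out).ne'
  have hP : 0 < p.toReal := ENNReal.toReal_pos hp hp'
  have h1 : Filter.Tendsto (fun n => ∫ a, ‖f n a - x a‖ ^ p.toReal ∂μ) Filter.atTop
      (nhds (∫ _, 0 ∂μ)) := by
    refine tendsto_integral_of_dominated_convergence (fun a => ‖((2 : ℂ) • g) a‖ ^ p.toReal)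
      (fun n => ?_) (integrable_norm_rpow_toReal hp hp' _) (fun n => ?_) ?_
    · exact ((((Lp.aestronglyMeasurable (f n)).sub
        (Lp.aestronglyMeasurable x)).norm.aemeasurable).pow_const _).aestronglyMeasurable
    · filter_upwards [ae_all_iff.2 hb, h, Lp.coeFn_smul (2 : ℂ) g] with a h1 h2 h3
      have h4 : ‖x a‖ ≤ ‖g a‖ :=
        le_of_tendsto h2.norm (Filter.Eventually.of_forall fun n => h1 n)
      rw [Real.norm_of_nonneg (by positivity), h3, Pi.smul_apply, norm_smul, Complex.norm_ofNat,
        two_mul]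
      refine Real.rpow_le_rpow (norm_nonneg _) ((norm_sub_le _ _).trans ?_) hP.le
      exact add_le_add (h1 n) h4
    · filter_upwards [h] with a h1
      have h2 := ((tendsto_iff_norm_sub_tendsto_zero.1 h1).rpow_const (p := p.toReal)
        (Or.inr hP.le))
      rwa [Real.zero_rpow hP.ne'] at h2
  have h2 : ∀ n, ∫ a, ‖f n a - x a‖ ^ p.toReal ∂μ = ‖f n - x‖ ^ p.toReal := fun n => by
    rw [norm_rpow_toReal hp hp']
    refine integral_congr_ae ?_
    filter_upwards [Lp.coeFn_sub (f n) x] with a h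
    rw [h, Pi.sub_apply]
  simp only [h2, integral_zero] at h1
  have h3 := h1.rpow_const (p := p.toReal⁻¹) (Or.inr (by positivity))
  rw [Real.zero_rpow (by positivity)] at h3
  rw [tendsto_iff_norm_sub_tendsto_zero]
  refine h3.congr fun n => ?_
  rw [← Real.rpow_mul (norm_nonneg _), mul_inv_cancel₀ hP.ne', Real.rpow_one]

/-- The `p`-th root of a strictly positive integrable function; it replaces the constant `1`, which
need not lie in `L^p`. -/
theorem exists_ae_ne_zero [SigmaFinite μ] (hp' : p ≠ ∞) :
    ∃ w : Lp ℂ p μ, ∀ᵐ a ∂μ, w a ≠ 0 := by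
  have hp : p ≠ 0 := (zero_lt_one.trans_le Fact.out).ne'
  have hP : 0 < p.toReal := ENNReal.toReal_pos hp hp'
  obtain ⟨g, hg, hgm, hgi⟩ := exists_pos_lintegral_lt_of_sigmaFinite μ one_ne_zero
  let f : Ω → ℂ := fun a => (((g a : ℝ) ^ p.toReal⁻¹ : ℝ) : ℂ)
  have hf : MemLp f p μ := by
    refine ⟨(Complex.measurable_ofReal.comp
      (hgm.coe_nnreal_real.pow_const _)).aestronglyMeasurable, ?_⟩
    rw [eLpNorm_lt_top_iff_lintegral_rpow_enorm_lt_top hp hp']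
    refine lt_of_eq_of_lt (lintegral_congr fun a => ?_) (hgi.trans ENNReal.one_lt_top)
    rw [← ofReal_norm, Complex.norm_real, Real.norm_of_nonneg (by positivity),
      ENNReal.ofReal_rpow_of_nonneg (by positivity) hP.le, ← Real.rpow_mul (by positivity),
      inv_mul_cancel₀ hP.ne', Real.rpow_one, ENNReal.ofReal_coe_nnreal]
  refine ⟨hf.toLp, ?_⟩
  filter_upwards [hf.coeFn_toLp] with a h
  rw [h]
  exact Complex.ofReal_ne_zero.2 (Real.rpow_pos_of_pos (NNReal.coe_pos.2 (hg a)) _).ne'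

/-- The multiples of a nowhere vanishing `w` by characteristic functions span `L^p`. -/
theorem eq_of_apply_indicatorCLM_eq {Y : Type*} [NormedAddCommGroup Y] [NormedSpace ℂ Y]
    (hp' : p ≠ ∞) {w : Lp ℂ p μ} (hw : ∀ᵐ a ∂μ, w a ≠ 0) {s t : Lp ℂ p μ →L[ℂ] Y}
    (h : ∀ (A : Set Ω) (hA : MeasurableSet A),
      s (indicatorCLM p μ hA w) = t (indicatorCLM p μ hA w)) : s = t := by
  have hsimple : ∀ φ : SimpleFunc Ω ℂ, ∃ f : Lp ℂ p μ, s f = t f ∧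
      f =ᵐ[μ] fun a => φ a * w a := by
    intro φ
    induction φ using SimpleFunc.induction with
    | const c hA =>
      refine ⟨c • indicatorCLM p μ hA w, by rw [map_smul, map_smul, h], ?_⟩
      filter_upwards [Lp.coeFn_smul c (indicatorCLM p μ hA w), coeFn_indicatorCLM hA w]
        with a h1 h2
      rw [h1, Pi.smul_apply, h2]
      rename_i A
      by_cases ha : a ∈ A <;> simp [ha]
    | add _ hf hg =>
      obtain ⟨f, hf1, hf2⟩ := hf
      obtain ⟨g, hg1, hg2⟩ := hg
      refine ⟨f + g, by rw [map_add, map_add, hf1, hg1], ?_⟩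
      filter_upwards [Lp.coeFn_add f g, hf2, hg2] with a h1 h2 h3
      rw [h1, Pi.add_apply, h2, h3, SimpleFunc.coe_add, Pi.add_apply, add_mul]
  choose F hF1 hF2 using hsimple
  ext1 x
  have hm : Measurable fun a => x a / w a :=
    (Lp.stronglyMeasurable x).measurable.div (Lp.stronglyMeasurable w).measurable
  -- Simple functions approximate `x / w` with `|φ n| ≤ 2 |x / w|`, so `φ n · w` converges to `x`
  -- and is dominated by `2 |x|`.
  let φ : ℕ → SimpleFunc Ω ℂ := SimpleFunc.approxOn _ hm Set.univ 0 (Set.mem_univ 0)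
  have hlim : Filter.Tendsto (fun n => F (φ n)) Filter.atTop (nhds x) := by
    refine tendsto_of_dominated hp' (g := (2 : ℂ) • x) (fun n => ?_) ?_
    · filter_upwards [hF2 (φ n), Lp.coeFn_smul (2 : ℂ) x, hw] with a h1 h2 h3
      have h4 : ‖φ n a‖ ≤ ‖x a / w a‖ + ‖x a / w a‖ :=
        SimpleFunc.norm_approxOn_zero_le hm (Set.mem_univ 0) a n
      have h5 : 0 < ‖w a‖ := norm_pos_iff.2 h3
      rw [h1, h2, norm_mul, Pi.smul_apply, norm_smul, Complex.norm_ofNat]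
      refine (mul_le_mul_of_nonneg_right h4 h5.le).trans_eq ?_
      rw [norm_div]
      field_simp
      ring
    · filter_upwards [ae_all_iff.2 fun n => hF2 (φ n), hw] with a h1 h2
      simp only [h1]
      have h3 : Filter.Tendsto (fun n => φ n a) Filter.atTop (nhds (x a / w a)) :=
        SimpleFunc.tendsto_approxOn hm (Set.mem_univ 0) (by simp)
      simpa [h2] using h3.mul_const (w a)
  have hs := (s.continuous.tendsto x).comp hlim
  have ht := (t.continuous.tendsto x).comp hlim
  refine tendsto_nhds_unique hs (ht.congr fun n => ?_)
  exact (hF1 (φ n)).symm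

end MeasureTheory.Lp

/-! ### The bounded operator of a spatial system -/

namespace SpatialSystem

variable {Ω₀ Ω₁ : Type*} [MeasurableSpace Ω₀] [MeasurableSpace Ω₁]
  {μ : Measure Ω₀} {ν : Measure Ω₁} (σ : SpatialSystem μ ν)

theorem pushforward_congr_ae {ξ ζ' : Ω₀ → ℂ} (hξ : Measurable ξ) (hζ' : Measurable ζ')
    (h : ξ =ᵐ[μ] ζ') : σ.S.pushforward ξ =ᵐ[ν.restrict σ.F] σ.S.pushforward ζ' :=
  ((σ.isPushforward hξ).congr hξ hζ' (ae_restrict_of_ae h) .rfl).ae_eq (σ.isPushforward hζ')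

variable [SigmaFinite μ] [SigmaFinite ν] {p : ℝ≥0∞} [Fact (1 ≤ p)]

theorem memLp_weighted (hp' : p ≠ ∞) (ξ : Lp ℂ p μ) : MemLp (σ.weighted p ξ) p ν := by
  have hξ : Measurable ξ := (Lp.stronglyMeasurable ξ).measurable
  refine ⟨?_, ?_⟩
  · refine AEMeasurable.aestronglyMeasurable ?_
    refine (aemeasurable_indicator_iff σ.measurableSet_F).2 ?_
    refine (AEMeasurable.mul ?_ ((σ.isPushforward hξ).aemeasurable hξ)).mul
      σ.measurable_g.aemeasurable
    exact (Complex.measurable_ofReal.comp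
      (σ.measurable_density.ennreal_toReal.pow_const _)).aemeasurable
  · rw [σ.eLpNorm_weighted' hp' hξ]
    exact (eLpNorm_mono_measure _ Measure.restrict_le_self).trans_lt (Lp.eLpNorm_lt_top ξ)

/-- The operator on `L^p` defined by a spatial system. -/
noncomputable def toLinearMap (hp' : p ≠ ∞) : Lp ℂ p μ →ₗ[ℂ] Lp ℂ p ν where
  toFun ξ := (σ.memLp_weighted hp' ξ).toLp
  map_add' ξ η := by
    have hξ : Measurable ξ := (Lp.stronglyMeasurable ξ).measurable
    have hη : Measurable η := (Lp.stronglyMeasurable η).measurable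
    -- `S_* ξ + S_* η` corresponds to `ξ + η`; uniqueness identifies it with `S_*(ξ + η)`.
    have h := ((σ.isPushforward hξ).prodMk σ.univ_ae hξ hη (σ.isPushforward hη)).comp
      (φ := fun z : ℂ × ℂ => z.1 + z.2) (by fun_prop)
    have h1 := ((σ.pushforward_congr_ae (Lp.stronglyMeasurable (ξ + η)).measurable
      (hξ.add hη) (Lp.coeFn_add ξ η))).trans ((σ.isPushforward (hξ.add hη)).ae_eq h)
    rw [← MemLp.toLp_add, MemLp.toLp_eq_toLp_iff]
    filter_upwards [(ae_restrict_iff' σ.measurableSet_F).1 h1] with y h2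
    rw [Pi.add_apply, weighted, weighted, weighted]
    by_cases hy : y ∈ σ.F
    · simp only [Set.indicator_of_mem hy]
      rw [h2 hy]
      ring
    · simp [hy]
  map_smul' c ξ := by
    have hξ : Measurable ξ := (Lp.stronglyMeasurable ξ).measurable
    have h := (σ.isPushforward hξ).comp (φ := fun z : ℂ => c * z) (by fun_prop)
    have h1 := ((σ.pushforward_congr_ae (Lp.stronglyMeasurable (c • ξ)).measurable
      (hξ.const_mul c) (Lp.coeFn_smul c ξ))).trans ((σ.isPushforward (hξ.const_mul c)).ae_eq h)
    rw [RingHom.id_apply, ← MemLp.toLp_const_smul, MemLp.toLp_eq_toLp_iff]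
    filter_upwards [(ae_restrict_iff' σ.measurableSet_F).1 h1] with y h2
    rw [Pi.smul_apply, weighted, weighted]
    by_cases hy : y ∈ σ.F
    · simp only [Set.indicator_of_mem hy]
      rw [h2 hy, smul_eq_mul]
      ring
    · simp [hy]

/-- The bounded operator on `L^p` defined by a spatial system. -/
noncomputable def toCLM (hp' : p ≠ ∞) : Lp ℂ p μ →L[ℂ] Lp ℂ p ν :=
  (σ.toLinearMap hp').mkContinuous 1 fun ξ => by
    rw [one_mul]
    exact (σ.norm_apply hp' (s := σ.toLinearMap hp')
      (fun ξ => (σ.memLp_weighted hp' ξ).coeFn_toLp) ξ).trans_le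
      (Lp.norm_indicatorCLM_apply_le _ ξ)

theorem coeFn_toCLM (hp' : p ≠ ∞) (ξ : Lp ℂ p μ) : σ.toCLM hp' ξ =ᵐ[ν] σ.weighted p ξ :=
  (σ.memLp_weighted hp' ξ).coeFn_toLp

end SpatialSystem

/-! ### The Banach–Lamperti theorem -/

theorem MeasureTheory.ae_enorm_eq_of_eLpNorm_restrict_eq {Ω : Type*} [MeasurableSpace Ω]
    {ν : Measure Ω} [SigmaFinite ν] {p : ℝ≥0∞} (hp : p ≠ 0) (hp' : p ≠ ∞) {a b : Ω → ℂ}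
    (ha : AEMeasurable a ν) (hb : AEMeasurable b ν)
    (h : ∀ B, MeasurableSet B → eLpNorm a p (ν.restrict B) = eLpNorm b p (ν.restrict B)) :
    ∀ᵐ y ∂ν, ‖a y‖ = ‖b y‖ := by
  have hP : 0 < p.toReal := ENNReal.toReal_pos hp hp'
  have h1 : (fun y => ‖a y‖ₑ ^ p.toReal) =ᵐ[ν] fun y => ‖b y‖ₑ ^ p.toReal := by
    refine ae_eq_of_forall_setLIntegral_eq_of_sigmaFinite₀ (ha.enorm.pow_const _)
      (hb.enorm.pow_const _) fun B hB _ => ?_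
    have h2 := h B hB
    rw [eLpNorm_eq_lintegral_rpow_enorm_toReal hp hp',
      eLpNorm_eq_lintegral_rpow_enorm_toReal hp hp'] at h2
    exact ENNReal.rpow_left_injective (by positivity) h2
  filter_upwards [h1] with y hy
  rw [← toReal_enorm, ← toReal_enorm, ENNReal.rpow_left_injective hP.ne' hy]

/-- Mutually inverse isometries between `χ_E L^p(μ)` and `χ_F L^p(ν)`, as operators on `L^p`. -/
structure LpIsometricPair {Ω₀ Ω₁ : Type*} [MeasurableSpace Ω₀] [MeasurableSpace Ω₁]
    (μ : Measure Ω₀) (ν : Measure Ω₁) (p : ℝ≥0∞) [Fact (1 ≤ p)] where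
  E : Set Ω₀
  F : Set Ω₁
  measurableSet_E : MeasurableSet E
  measurableSet_F : MeasurableSet F
  s : Lp ℂ p μ →L[ℂ] Lp ℂ p ν
  t : Lp ℂ p ν →L[ℂ] Lp ℂ p μ
  norm_s : ∀ x, ‖s x‖ = ‖Lp.indicatorCLM p μ measurableSet_E x‖
  norm_t : ∀ y, ‖t y‖ = ‖Lp.indicatorCLM p ν measurableSet_F y‖
  s_t : ∀ y, s (t y) = Lp.indicatorCLM p ν measurableSet_F y
  t_s : ∀ x, t (s x) = Lp.indicatorCLM p μ measurableSet_E x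

namespace LpIsometricPair

variable {Ω₀ Ω₁ : Type*} [MeasurableSpace Ω₀] [MeasurableSpace Ω₁]
  {μ : Measure Ω₀} {ν : Measure Ω₁} {p : ℝ≥0∞} [Fact (1 ≤ p)]

/-- The pair with the roles of the two operators exchanged. -/
def symm (d : LpIsometricPair μ ν p) : LpIsometricPair ν μ p where
  E := d.F
  F := d.E
  measurableSet_E := d.measurableSet_F
  measurableSet_F := d.measurableSet_E
  s := d.t
  t := d.s
  norm_s := d.norm_t
  norm_t := d.norm_s
  s_t := d.t_s
  t_s := d.s_t

theorem s_eq_iff (d : LpIsometricPair μ ν p) {x x' : Lp ℂ p μ} :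
    d.s x = d.s x' ↔ ∀ᵐ a ∂(μ.restrict d.E), x a = x' a := by
  rw [← sub_eq_zero, ← map_sub, ← norm_eq_zero, d.norm_s, norm_eq_zero, map_sub, sub_eq_zero,
    Lp.ext_iff, ae_restrict_iff' d.measurableSet_E]
  have h1 := Lp.coeFn_indicatorCLM d.measurableSet_E x
  have h2 := Lp.coeFn_indicatorCLM d.measurableSet_E x'
  constructor
  · intro h
    filter_upwards [h1, h2, h] with a h1 h2 h ha
    rwa [h1, h2, Set.indicator_of_mem ha, Set.indicator_of_mem ha] at h
  · intro h
    filter_upwards [h1, h2, h] with a h1 h2 h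
    rw [h1, h2]
    by_cases ha : a ∈ d.E
    · rw [Set.indicator_of_mem ha, Set.indicator_of_mem ha, h ha]
    · rw [Set.indicator_of_notMem ha, Set.indicator_of_notMem ha]

theorem s_eq_zero_iff (d : LpIsometricPair μ ν p) {x : Lp ℂ p μ} :
    d.s x = 0 ↔ ∀ᵐ a ∂(μ.restrict d.E), x a = 0 := by
  rw [← map_zero d.s, s_eq_iff]
  refine Filter.eventually_congr ?_
  filter_upwards [ae_restrict_of_ae (Lp.coeFn_zero ℂ p μ)] with a h
  rw [h, Pi.zero_apply]

/-- `‖χ_F s x‖ = ‖t s x‖ = ‖χ_E x‖ = ‖s x‖`, so `s x` has no part off `F`. -/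
theorem indicatorCLM_s (d : LpIsometricPair μ ν p) (hp' : p ≠ ∞) (x : Lp ℂ p μ) :
    Lp.indicatorCLM p ν d.measurableSet_F (d.s x) = d.s x :=
  Lp.indicatorCLM_eq_self_of_norm_eq _ hp' (by rw [← d.norm_t, d.t_s, d.norm_s])

theorem s_eq_s_iff (d : LpIsometricPair μ ν p) (hp' : p ≠ ∞) {x x' : Lp ℂ p μ} :
    d.s x = d.s x' ↔ ∀ᵐ b ∂(ν.restrict d.F), d.s x b = d.s x' b := by
  refine Iff.trans ⟨fun h => congrArg d.t h, fun h => ?_⟩ d.symm.s_eq_iff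
  rw [← d.indicatorCLM_s hp' x, ← d.indicatorCLM_s hp' x', ← d.s_t, ← d.s_t, h]

theorem s_eq_zero_iff' (d : LpIsometricPair μ ν p) (hp' : p ≠ ∞) {x : Lp ℂ p μ} :
    d.s x = 0 ↔ ∀ᵐ b ∂(ν.restrict d.F), d.s x b = 0 := by
  refine Iff.trans ?_ (d.symm.s_eq_zero_iff (x := d.s x))
  change _ ↔ d.t (d.s x) = 0
  refine ⟨fun h => by rw [h, map_zero], fun h => ?_⟩
  rw [← d.indicatorCLM_s hp' x, ← d.s_t]
  exact (congrArg d.s h).trans (map_zero _)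

theorem eLpNorm_s (d : LpIsometricPair μ ν p) (hp' : p ≠ ∞) (x : Lp ℂ p μ) :
    eLpNorm (d.s x) p (ν.restrict d.F) = eLpNorm x p (μ.restrict d.E) := by
  rw [← Lp.enorm_indicatorCLM_apply d.measurableSet_F,
    ← Lp.enorm_indicatorCLM_apply d.measurableSet_E, d.indicatorCLM_s hp', ← ofReal_norm,
    d.norm_s, ofReal_norm]

section Supports

variable (d : LpIsometricPair μ ν p) (w : Lp ℂ p μ)

open Classical in
/-- The support of `s(χ_A w)`. -/
def supp (A : Set Ω₀) : Set Ω₁ :=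
  if hA : MeasurableSet A then {b | d.s (Lp.indicatorCLM p μ hA w) b ≠ 0} else ∅

variable {A B : Set Ω₀}

theorem mem_supp (hA : MeasurableSet A) {b : Ω₁} :
    b ∈ d.supp w A ↔ d.s (Lp.indicatorCLM p μ hA w) b ≠ 0 := by
  rw [supp, dif_pos hA]; rfl

theorem measurableSet_supp (hA : MeasurableSet A) : MeasurableSet (d.supp w A) := by
  rw [supp, dif_pos hA]
  exact ((Lp.stronglyMeasurable _).measurable (measurableSet_singleton 0)).compl

theorem indicatorCLM_univ : Lp.indicatorCLM p μ MeasurableSet.univ w = w := by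
  refine Lp.ext ?_
  filter_upwards [Lp.coeFn_indicatorCLM MeasurableSet.univ w] with a h
  rw [h, Set.indicator_univ]

theorem mem_supp_univ {b : Ω₁} : b ∈ d.supp w Set.univ ↔ d.s w b ≠ 0 := by
  rw [d.mem_supp w MeasurableSet.univ, indicatorCLM_univ]

theorem disjoint_supp_ae (hp' : p ≠ ∞) (hp2 : p ≠ 2) (hA : MeasurableSet A) (hB : MeasurableSet B)
    (hAB : Disjoint A B) : ∀ᵐ b ∂ν, d.s (Lp.indicatorCLM p μ hA w) b = 0 ∨
      d.s (Lp.indicatorCLM p μ hB w) b = 0 := by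
  refine Lp.disjoint_apply_of_norm_eq hp' hp2 d.measurableSet_E d.norm_s ?_
  filter_upwards [Lp.coeFn_indicatorCLM hA w, Lp.coeFn_indicatorCLM hB w] with a h1 h2
  rw [h1, h2]
  by_cases ha : a ∈ A
  · exact Or.inr (Set.indicator_of_notMem (Set.disjoint_left.1 hAB ha) _)
  · exact Or.inl (Set.indicator_of_notMem ha _)

theorem s_indicatorCLM_add_compl (hA : MeasurableSet A) : ∀ᵐ b ∂ν,
    d.s (Lp.indicatorCLM p μ hA w) b + d.s (Lp.indicatorCLM p μ hA.compl w) b = d.s w b := by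
  have h : Lp.indicatorCLM p μ hA w + Lp.indicatorCLM p μ hA.compl w = w := by
    refine Lp.ext ?_
    filter_upwards [Lp.coeFn_add (Lp.indicatorCLM p μ hA w) (Lp.indicatorCLM p μ hA.compl w),
      Lp.coeFn_indicatorCLM hA w, Lp.coeFn_indicatorCLM hA.compl w] with a h1 h2 h3
    rw [h1, Pi.add_apply, h2, h3, Set.indicator_self_add_compl_apply]
  have h' : d.s (Lp.indicatorCLM p μ hA w) + d.s (Lp.indicatorCLM p μ hA.compl w) = d.s w := by
    rw [← map_add, h]
  filter_upwards [Lp.coeFn_add (d.s (Lp.indicatorCLM p μ hA w))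
    (d.s (Lp.indicatorCLM p μ hA.compl w))] with b hb
  rw [← h', hb, Pi.add_apply]

/-- `s(χ_A w)` and `s(χ_{Aᶜ} w)` have disjoint supports and sum to `s w`, so each is `s w` cut down
to its own support. -/
theorem s_indicatorCLM_ae (hp' : p ≠ ∞) (hp2 : p ≠ 2) (hA : MeasurableSet A) :
    d.s (Lp.indicatorCLM p μ hA w) =ᵐ[ν] (d.supp w A).indicator (d.s w) := by
  filter_upwards [d.s_indicatorCLM_add_compl w hA,
    d.disjoint_supp_ae w hp' hp2 hA hA.compl disjoint_compl_right] with b h1 h2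
  by_cases hb : b ∈ d.supp w A
  · rw [Set.indicator_of_mem hb, ← h1, h2.resolve_left ((d.mem_supp w hA).1 hb), add_zero]
  · rw [Set.indicator_of_notMem hb]
    rw [d.mem_supp w hA] at hb
    exact not_not.1 hb

theorem supp_mono_ae (hp' : p ≠ ∞) (hp2 : p ≠ 2) (hA : MeasurableSet A) (hB : MeasurableSet B)
    (hAB : A ⊆ B) : ∀ᵐ b ∂ν, b ∈ d.supp w A → b ∈ d.supp w B := by
  filter_upwards [d.s_indicatorCLM_ae w hp' hp2 hA, d.s_indicatorCLM_add_compl w hB,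
    d.disjoint_supp_ae w hp' hp2 hA hB.compl (Set.disjoint_compl_right_iff_subset.2 hAB)]
    with b h1 h2 h3 hb
  have h4 := (d.mem_supp w hA).1 hb
  rw [d.mem_supp w hB]
  rw [h3.resolve_left h4, add_zero] at h2
  rwa [h2, ← Set.indicator_of_mem hb (d.s w), ← h1]

/-- Since `t` preserves disjointness, `t y` is disjoint from every `χ_E χ_{A n} w`. These supports
cover `E`, so `t y` vanishes on `E` and `y` on `F`. Full support and countable additivity both
follow by choosing `y`. -/
theorem eq_zero_of_disjoint_supp (hp' : p ≠ ∞) (hp2 : p ≠ 2) (hw : ∀ᵐ a ∂μ, w a ≠ 0)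
    {A : ℕ → Set Ω₀} (hA : ∀ n, MeasurableSet (A n)) (hU : ⋃ n, A n = Set.univ) {y : Lp ℂ p ν}
    (h : ∀ n, ∀ᵐ b ∂ν, y b = 0 ∨ d.s (Lp.indicatorCLM p μ (hA n) w) b = 0) :
    ∀ᵐ b ∂(ν.restrict d.F), y b = 0 := by
  have h1 : ∀ n, ∀ᵐ a ∂μ, d.t y a = 0 ∨
      Lp.indicatorCLM p μ d.measurableSet_E (Lp.indicatorCLM p μ (hA n) w) a = 0 := fun n => by
    rw [← d.t_s]
    exact Lp.disjoint_apply_of_norm_eq hp' hp2 d.measurableSet_F d.norm_t (h n)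
  refine d.symm.s_eq_zero_iff.1 ((d.symm.s_eq_zero_iff' hp').2 ?_)
  refine (ae_restrict_iff' d.measurableSet_E).2 ?_
  filter_upwards [ae_all_iff.2 h1, hw, ae_all_iff.2 fun n => Lp.coeFn_indicatorCLM (hA n) w,
    ae_all_iff.2 fun n => Lp.coeFn_indicatorCLM d.measurableSet_E (Lp.indicatorCLM p μ (hA n) w)]
    with a h1 h2 h3 h4 ha
  obtain ⟨n, hn⟩ := Set.mem_iUnion.1 (hU ▸ Set.mem_univ a)
  refine (h1 n).resolve_right ?_
  rwa [h4, Set.indicator_of_mem ha, h3, Set.indicator_of_mem hn]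

theorem supp_univ_ae [SigmaFinite ν] (hp' : p ≠ ∞) (hp2 : p ≠ 2) (hw : ∀ᵐ a ∂μ, w a ≠ 0) :
    ∀ᵐ b ∂(ν.restrict d.F), d.s w b ≠ 0 := by
  obtain ⟨u, hu⟩ := Lp.exists_ae_ne_zero (μ := ν) hp'
  -- Test with a nowhere vanishing `u` cut down to the zero set of `s w`.
  have hC : MeasurableSet {b | d.s w b = 0} :=
    (Lp.stronglyMeasurable _).measurable (measurableSet_singleton 0)
  have h := d.eq_zero_of_disjoint_supp w hp' hp2 hw (A := fun _ => Set.univ)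
    (fun _ => MeasurableSet.univ) (Set.iUnion_const _) (y := Lp.indicatorCLM p ν hC u) (by
      intro n
      rw [indicatorCLM_univ]
      filter_upwards [Lp.coeFn_indicatorCLM hC u] with b h1
      rw [h1]
      by_cases hb : d.s w b = 0
      · exact Or.inr hb
      · exact Or.inl (Set.indicator_of_notMem (by exact hb) _))
  filter_upwards [h, ae_restrict_of_ae hu, ae_restrict_of_ae (Lp.coeFn_indicatorCLM hC u)]
    with b h1 h2 h3 h4
  rw [h3, Set.indicator_of_mem (by exact h4)] at h1
  exact h2 h1

theorem supp_iUnion_ae (hp' : p ≠ ∞) (hp2 : p ≠ 2) (hw : ∀ᵐ a ∂μ, w a ≠ 0) {A : ℕ → Set Ω₀}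
    (hA : ∀ n, MeasurableSet (A n)) :
    d.supp w (⋃ n, A n) =ᵐ[ν.restrict d.F] (⋃ n, d.supp w (A n) : Set Ω₁) := by
  have hU : MeasurableSet (⋃ n, A n) := MeasurableSet.iUnion hA
  have hC : MeasurableSet (⋃ n, d.supp w (A n))ᶜ :=
    (MeasurableSet.iUnion fun n => d.measurableSet_supp w (hA n)).compl
  -- The complement of the union is put first to obtain a cover of the whole space. The test
  -- function is the part of `s(χ_{⋃ A n} w)` outside all the supports of `s(χ_{A n} w)`; it is
  -- disjoint from the image of each piece.
  let D : ℕ → Set Ω₀ := fun n => Nat.casesOn n (⋃ n, A n)ᶜ A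
  have hD : ∀ n, MeasurableSet (D n) := by
    rintro (_ | n)
    · exact hU.compl
    · exact hA n
  have hDU : ⋃ n, D n = Set.univ := by
    refine Set.eq_univ_of_forall fun a => ?_
    by_cases ha : a ∈ ⋃ n, A n
    · obtain ⟨n, hn⟩ := Set.mem_iUnion.1 ha
      exact Set.mem_iUnion.2 ⟨n + 1, hn⟩
    · exact Set.mem_iUnion.2 ⟨0, ha⟩
  have h := d.eq_zero_of_disjoint_supp w hp' hp2 hw hD hDU
    (y := Lp.indicatorCLM p ν hC (d.s (Lp.indicatorCLM p μ hU w))) (by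
      rintro (_ | n)
      · filter_upwards [Lp.coeFn_indicatorCLM hC (d.s (Lp.indicatorCLM p μ hU w)),
          d.disjoint_supp_ae w hp' hp2 hU hU.compl disjoint_compl_right] with b h1 h2
        rw [h1]
        exact h2.imp_left fun h => Set.indicator_apply_eq_zero.2 fun _ => h
      · filter_upwards [Lp.coeFn_indicatorCLM hC (d.s (Lp.indicatorCLM p μ hU w))] with b h1
        rw [h1]
        by_cases hb : b ∈ d.supp w (A n)
        · exact Or.inl (Set.indicator_of_notMem
            (Set.notMem_compl_iff.2 (Set.mem_iUnion.2 ⟨n, hb⟩)) _)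
        · rw [d.mem_supp w (hA n)] at hb
          exact Or.inr (not_not.1 hb))
  refine Filter.eventuallyEq_set.2 ?_
  filter_upwards [h, ae_restrict_of_ae (Lp.coeFn_indicatorCLM hC (d.s (Lp.indicatorCLM p μ hU w))),
    ae_restrict_of_ae (ae_all_iff.2 fun n =>
      d.supp_mono_ae w hp' hp2 (hA n) hU (Set.subset_iUnion A n))] with b h1 h2 h3
  constructor
  · intro hb
    by_contra hn
    rw [h2, Set.indicator_of_mem (by exact hn)] at h1
    exact (d.mem_supp w hU).1 hb h1
  · intro hb
    obtain ⟨n, hn⟩ := Set.mem_iUnion.1 hb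
    exact h3 n hn

/-- The measurable set transformation sending `A` to the support of `s(χ_A w)`. -/
def transformation (hp' : p ≠ ∞) (hp2 : p ≠ 2) (hw : ∀ᵐ a ∂μ, w a ≠ 0) :
    MeasurableSetTransformation (μ.restrict d.E) (ν.restrict d.F) where
  toFun := d.supp w
  measurableSet_toFun _ hA := d.measurableSet_supp w hA
  congr_toFun A B hA hB h := by
    have e : d.s (Lp.indicatorCLM p μ hA w) = d.s (Lp.indicatorCLM p μ hB w) := by
      refine d.s_eq_iff.2 ?_
      filter_upwards [ae_restrict_of_ae (Lp.coeFn_indicatorCLM hA w),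
        ae_restrict_of_ae (Lp.coeFn_indicatorCLM hB w), Filter.eventuallyEq_set.1 h]
        with a h1 h2 h3
      rw [h1, h2]
      by_cases ha : a ∈ A
      · rw [Set.indicator_of_mem ha, Set.indicator_of_mem (h3.1 ha)]
      · rw [Set.indicator_of_notMem ha, Set.indicator_of_notMem (fun h => ha (h3.2 h))]
    refine Filter.eventuallyEq_set.2 (Filter.Eventually.of_forall fun b => ?_)
    rw [d.mem_supp w hA, d.mem_supp w hB, e]
  null_iff A hA := by
    rw [measure_eq_zero_iff_ae_notMem, measure_eq_zero_iff_ae_notMem]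
    simp only [d.mem_supp w hA, not_not]
    rw [← d.s_eq_zero_iff' hp', d.s_eq_zero_iff]
    refine Filter.eventually_congr ?_
    filter_upwards [ae_restrict_of_ae (Lp.coeFn_indicatorCLM hA w), ae_restrict_of_ae hw]
      with a h1 h2
    rw [h1, Set.indicator_apply_eq_zero]
    exact ⟨fun h ha => h2 (h ha), fun h ha => absurd ha h⟩
  compl_toFun A hA := by
    refine Filter.eventuallyEq_set.2 ?_
    filter_upwards [ae_restrict_of_ae (d.s_indicatorCLM_add_compl w hA), ae_restrict_of_ae
      (d.disjoint_supp_ae w hp' hp2 hA hA.compl disjoint_compl_right)] with b h1 h2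
    rw [Set.mem_sdiff, d.mem_supp_univ, d.mem_supp w hA, d.mem_supp w hA.compl, ← h1]
    rcases h2 with h | h <;> simp [h]
  iUnion_toFun _ hA _ := d.supp_iUnion_ae w hp' hp2 hw hA

/-- The support determines `s(χ_A w)`, hence `A` modulo null sets in `E`. For surjectivity, cut `s
w` along `B`: as `t` preserves disjointness, `t(χ_B s w)` is on `E` the restriction of `w` to its
own support, which serves as `A`. -/
theorem isBijective_transformation [SigmaFinite ν] (hp' : p ≠ ∞) (hp2 : p ≠ 2)
    (hw : ∀ᵐ a ∂μ, w a ≠ 0) : (d.transformation w hp' hp2 hw).IsBijective := by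
  constructor
  · intro A B hA hB h
    have e : d.s (Lp.indicatorCLM p μ hA w) = d.s (Lp.indicatorCLM p μ hB w) := by
      refine (d.s_eq_s_iff hp').2 ?_
      filter_upwards [ae_restrict_of_ae (d.s_indicatorCLM_ae w hp' hp2 hA),
        ae_restrict_of_ae (d.s_indicatorCLM_ae w hp' hp2 hB), Filter.eventuallyEq_set.1 h]
        with b h1 h2 h3
      change b ∈ d.supp w A ↔ b ∈ d.supp w B at h3
      rw [h1, h2]
      by_cases hb : b ∈ d.supp w A
      · rw [Set.indicator_of_mem hb, Set.indicator_of_mem (h3.1 hb)]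
      · rw [Set.indicator_of_notMem hb, Set.indicator_of_notMem (fun h => hb (h3.2 h))]
    refine Filter.eventuallyEq_set.2 ?_
    filter_upwards [d.s_eq_iff.1 e, ae_restrict_of_ae (Lp.coeFn_indicatorCLM hA w),
      ae_restrict_of_ae (Lp.coeFn_indicatorCLM hB w), ae_restrict_of_ae hw] with a h1 h2 h3 h4
    rw [h2, h3] at h1
    by_cases ha : a ∈ A <;> by_cases hb : a ∈ B <;> simp_all
  · intro B hB
    set y := Lp.indicatorCLM p ν hB (d.s w)
    set y' := Lp.indicatorCLM p ν hB.compl (d.s w)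
    have hy : y + y' = d.s w := by
      refine Lp.ext ?_
      filter_upwards [Lp.coeFn_add y y', Lp.coeFn_indicatorCLM hB (d.s w),
        Lp.coeFn_indicatorCLM hB.compl (d.s w)] with b h1 h2 h3
      rw [h1, Pi.add_apply, h2, h3, Set.indicator_self_add_compl_apply]
    have hty : d.t y + d.t y' = Lp.indicatorCLM p μ d.measurableSet_E w := by
      rw [← map_add, hy, d.t_s]
    have hdisj : ∀ᵐ a ∂μ, d.t y a = 0 ∨ d.t y' a = 0 := by
      refine Lp.disjoint_apply_of_norm_eq hp' hp2 d.measurableSet_F d.norm_t ?_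
      filter_upwards [Lp.coeFn_indicatorCLM hB (d.s w), Lp.coeFn_indicatorCLM hB.compl (d.s w)]
        with b h1 h2
      rw [h1, h2]
      by_cases hb : b ∈ B
      · exact Or.inr (Set.indicator_of_notMem (Set.notMem_compl_iff.2 hb) _)
      · exact Or.inl (Set.indicator_of_notMem hb _)
    have hA : MeasurableSet {a | d.t y a ≠ 0} :=
      ((Lp.stronglyMeasurable _).measurable (measurableSet_singleton 0)).compl
    have hsA : d.s (Lp.indicatorCLM p μ hA w) = Lp.indicatorCLM p ν d.measurableSet_F y := by
      rw [← d.s_t, d.s_eq_iff]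
      refine (ae_restrict_iff' d.measurableSet_E).2 ?_
      filter_upwards [Lp.coeFn_add (d.t y) (d.t y'), hdisj, Lp.coeFn_indicatorCLM hA w,
        Lp.coeFn_indicatorCLM d.measurableSet_E w] with a h1 h2 h3 h4 ha
      rw [hty, h4, Set.indicator_of_mem ha, Pi.add_apply] at h1
      rw [h3]
      by_cases h : d.t y a = 0
      · rw [Set.indicator_of_notMem (by simpa using h), h]
      · rw [Set.indicator_of_mem (by exact h), h1, h2.resolve_left h, add_zero]
    refine ⟨_, hA, Filter.eventuallyEq_set.2 ?_⟩
    filter_upwards [d.supp_univ_ae w hp' hp2 hw, ae_restrict_mem d.measurableSet_F,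
      ae_restrict_of_ae (Lp.coeFn_indicatorCLM d.measurableSet_F y),
      ae_restrict_of_ae (Lp.coeFn_indicatorCLM hB (d.s w))] with b h1 h2 h3 h4
    change b ∈ d.supp w _ ↔ _
    rw [d.mem_supp w hA, hsA, h3, Set.indicator_of_mem h2, h4]
    simp [h1]

end Supports

/-- The Banach–Lamperti theorem: for `p ≠ 2`, an isometry of `χ_E L^p(μ)` onto `χ_F L^p(ν)` is
given by a spatial system. -/
theorem isSpatialPartialIsometry [SigmaFinite μ] [SigmaFinite ν] (d : LpIsometricPair μ ν p)
    (hp' : p ≠ ∞) (hp2 : p ≠ 2) :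
    IsSpatialPartialIsometry (d.s : Lp ℂ p μ →ₗ[ℂ] Lp ℂ p ν) := by
  have hp : p ≠ 0 := (zero_lt_one.trans_le Fact.out).ne'
  obtain ⟨w, hw⟩ := Lp.exists_ae_ne_zero (μ := μ) hp'
  have hwm : Measurable w := (Lp.stronglyMeasurable w).measurable
  let σ₀ : SpatialSystem μ ν :=
    { E := d.E
      F := d.F
      measurableSet_E := d.measurableSet_E
      measurableSet_F := d.measurableSet_F
      S := d.transformation w hp' hp2 hw
      bijective_S := d.isBijective_transformation w hp' hp2 hw
      g := 1
      measurable_g := measurable_const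
      norm_g := by simp }
  let r : Ω₁ → ℂ := fun y => (((σ₀.density y).toReal ^ (1 / p.toReal) : ℝ) : ℂ)
  have hr : Measurable r := Complex.measurable_ofReal.comp
    (σ₀.measurable_density.ennreal_toReal.pow_const _)
  let z : Ω₁ → ℂ := σ₀.S.pushforward w
  have hzp : σ₀.S.IsPushforward w z := σ₀.isPushforward hwm
  have hz : AEMeasurable z (ν.restrict d.F) := hzp.aemeasurable hwm
  -- Multiplicativity: `S_*(χ_A w) = χ_{S(A)} S_* w`.
  have hpush : ∀ {A : Set Ω₀}, MeasurableSet A → σ₀.S.IsPushforward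
      (A.indicator w) ((d.supp w A).indicator z) := by
    intro A hA
    have h := ((σ₀.S.isPushforward_indicator σ₀.univ_ae hA).prodMk σ₀.univ_ae
      (measurable_one.indicator hA) hwm hzp).comp (φ := fun q : ℂ × ℂ => q.1 * q.2) (by fun_prop)
    simp only [← Set.indicator_mul_left, Pi.one_apply, one_mul] at h
    exact h
  -- Every measurable set is some `S(A)` modulo null sets in `F`; over it both functions have the
  -- norm of `χ_A w` on `E`.
  have hnorm : ∀ᵐ y ∂(ν.restrict d.F), ‖d.s w y‖ = ‖r y * z y‖ := by
    refine ae_enorm_eq_of_eLpNorm_restrict_eq hp hp'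
      (Lp.stronglyMeasurable _).measurable.aemeasurable (hr.aemeasurable.mul hz) fun B hB => ?_
    obtain ⟨A, hA, hAB⟩ := (d.isBijective_transformation w hp' hp2 hw).2 B hB
    change d.supp w A =ᵐ[_] B at hAB
    rw [← Measure.restrict_congr_set hAB,
      ← eLpNorm_indicator_eq_eLpNorm_restrict (d.measurableSet_supp w hA),
      ← eLpNorm_indicator_eq_eLpNorm_restrict (d.measurableSet_supp w hA),
      ← eLpNorm_congr_ae (ae_restrict_of_ae (d.s_indicatorCLM_ae w hp' hp2 hA)),
      d.eLpNorm_s hp', eLpNorm_congr_ae (ae_restrict_of_ae (Lp.coeFn_indicatorCLM hA w))]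
    refine (σ₀.eLpNorm_weighted hp hp' (hpush hA) (hwm.indicator hA)).symm.trans ?_
    congr 1
    ext y
    by_cases hy : y ∈ d.supp w A <;> simp [hy, r, σ₀]
  have hne := d.supp_univ_ae w hp' hp2 hw
  let σ : SpatialSystem μ ν :=
    { σ₀ with
      -- The phase still missing between `s w` and the weighted `S_* w`. The modification `hz.mk` is
      -- taken because `g` must be measurable, not just almost everywhere measurable.
      g := fun y => d.s w y / (r y * hz.mk z y)
      measurable_g := (Lp.stronglyMeasurable _).measurable.div (hr.mul hz.measurable_mk)
      norm_g := by
        filter_upwards [hnorm, hz.ae_eq_mk, hne] with y h1 h2 h3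
        rw [← h2, norm_div, ← h1, div_self (norm_ne_zero_iff.2 h3)] }
  have key : σ.toCLM hp' = d.s := by
    refine Lp.eq_of_apply_indicatorCLM_eq hp' hw fun A hA => Lp.ext ?_
    have hm : Measurable (Lp.indicatorCLM p μ hA w) := (Lp.stronglyMeasurable _).measurable
    have h1 : σ.S.pushforward (Lp.indicatorCLM p μ hA w) =ᵐ[ν.restrict d.F]
        (d.supp w A).indicator z :=
      (σ₀.isPushforward hm).ae_eq ((hpush hA).congr (hwm.indicator hA) hm
        (Filter.EventuallyEq.symm (ae_restrict_of_ae (Lp.coeFn_indicatorCLM hA w))) .rfl)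
    have hF := Lp.coeFn_indicatorCLM d.measurableSet_F (d.s (Lp.indicatorCLM p μ hA w))
    rw [d.indicatorCLM_s hp'] at hF
    filter_upwards [σ.coeFn_toCLM hp' (Lp.indicatorCLM p μ hA w), hF,
      d.s_indicatorCLM_ae w hp' hp2 hA, (ae_restrict_iff' d.measurableSet_F).1 h1,
      (ae_restrict_iff' d.measurableSet_F).1 hnorm, (ae_restrict_iff' d.measurableSet_F).1 hne,
      (ae_restrict_iff' d.measurableSet_F).1 hz.ae_eq_mk] with y h2 h3 h4 h5 h6 h7 h8
    rw [h2, SpatialSystem.weighted]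
    by_cases hy : y ∈ d.F
    · have hy' : y ∈ σ.F := hy
      rw [Set.indicator_of_mem hy', h5 hy, h4]
      change r y * _ * (d.s w y / (r y * hz.mk z y)) = _
      rw [← h8 hy]
      have h9 : r y * z y ≠ 0 := by
        rw [← norm_ne_zero_iff, ← h6 hy, norm_ne_zero_iff]
        exact h7 hy
      by_cases hyA : y ∈ d.supp w A
      · rw [Set.indicator_of_mem hyA, Set.indicator_of_mem hyA, mul_div_cancel₀ _ h9]
      · rw [Set.indicator_of_notMem hyA, Set.indicator_of_notMem hyA, mul_zero, zero_mul]
    · have hy' : y ∉ σ.F := hy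
      rw [Set.indicator_of_notMem hy', h3, Set.indicator_of_notMem hy]
  refine ⟨σ, fun ξ => ?_⟩
  rw [ContinuousLinearMap.coe_coe, ← key]
  exact σ.coeFn_toCLM hp' ξ

end LpIsometricPair

/-! ### The characterisation of spatial partial isometries -/

/-- The norm identity alone determines an idempotent, so `S` and `g` need not be examined. -/
theorem IsSpatialPartialIsometry.exists_eq_indicatorCLM {Ω : Type*} [MeasurableSpace Ω]
    {μ : Measure Ω} [SigmaFinite μ] {p : ℝ≥0∞} [Fact (1 ≤ p)] (hp_top : p ≠ ∞)
    {e : Lp ℂ p μ →L[ℂ] Lp ℂ p μ}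
    (h : IsSpatialPartialIsometry (e : Lp ℂ p μ →ₗ[ℂ] Lp ℂ p μ)) (he : IsIdempotentElem e) :
    ∃ (A : Set Ω) (hA : MeasurableSet A), e = Lp.indicatorCLM p μ hA := by
  obtain ⟨σ, hσ⟩ := h
  exact ⟨σ.E, σ.measurableSet_E, he.eq_indicatorCLM hp_top _ (σ.norm_apply hp_top hσ)⟩

theorem mainTheorem8 {Ω : Type*} [MeasurableSpace Ω] (μ : Measure Ω) [SigmaFinite μ]
    (p : ℝ≥0∞) [Fact (1 ≤ p)] (hp_top : p ≠ ∞) (hp_two : p ≠ 2)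
    (s : Lp ℂ p μ →L[ℂ] Lp ℂ p μ) :
    IsSpatialPartialIsometry (s : Lp ℂ p μ →ₗ[ℂ] Lp ℂ p μ) ↔
      ∃ t e f : Lp ℂ p μ →L[ℂ] Lp ℂ p μ,
        IsIdempotentElem e ∧ IsIdempotentElem f ∧
        IsSpatialPartialIsometry (e : Lp ℂ p μ →ₗ[ℂ] Lp ℂ p μ) ∧
        IsSpatialPartialIsometry (f : Lp ℂ p μ →ₗ[ℂ] Lp ℂ p μ) ∧
        s * t = f ∧ t * s = e ∧
        f * s * e = s ∧ e * t * f = t ∧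
        ‖s‖ ≤ 1 ∧ ‖t‖ ≤ 1 := by
  refine ⟨fun h => h.exists_partial_inverse hp_top, ?_⟩
  rintro ⟨t, e, f, he, hf, hse, hsf, hst, hts, hs, ht, hs1, ht1⟩
  obtain ⟨E, hE, rfl⟩ := hse.exists_eq_indicatorCLM hp_top he
  obtain ⟨F, hF, rfl⟩ := hsf.exists_eq_indicatorCLM hp_top hf
  have hst' : ∀ y, s (t y) = Lp.indicatorCLM p μ hF y := DFunLike.congr_fun hst
  have hts' : ∀ x, t (s x) = Lp.indicatorCLM p μ hE x := DFunLike.congr_fun hts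
  have hsle : ∀ x, ‖s x‖ ≤ ‖x‖ := fun x => by simpa using s.le_of_opNorm_le hs1 x
  have htle : ∀ x, ‖t x‖ ≤ ‖x‖ := fun x => by simpa using t.le_of_opNorm_le ht1 x
  have hsE : s * Lp.indicatorCLM p μ hE = s := by
    rw [← hs, mul_assoc, he.eq]
  have htF : t * Lp.indicatorCLM p μ hF = t := by
    rw [← ht, mul_assoc, hf.eq]
  -- Contractivity gives `‖s x‖ = ‖s χ_E x‖ ≤ ‖χ_E x‖ = ‖t s x‖ ≤ ‖s x‖`, and likewise for `t`.
  let d : LpIsometricPair μ μ p :=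
    { E := E
      F := F
      measurableSet_E := hE
      measurableSet_F := hF
      s := s
      t := t
      norm_s := fun x => le_antisymm
        ((congrArg norm (DFunLike.congr_fun hsE x)).symm.trans_le (hsle _))
        ((congrArg norm (hts' x)).symm.trans_le (htle _))
      norm_t := fun y => le_antisymm
        ((congrArg norm (DFunLike.congr_fun htF y)).symm.trans_le (htle _))
        ((congrArg norm (hst' y)).symm.trans_le (hsle _))
      s_t := hst'
      t_s := hts' }
  exact d.isSpatialPartialIsometry hp_top hp_two
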